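/- Let $\mathrm{Br}$ be a Bratteli diagram: a directed graph (multiple arrows allowed) with vertex set $\mathrm{Br}_V=\bigsqcup_{n\ge 0}\mathrm{Br}_n$, arrow set $\mathrm{Br}_{Ar}$, and source and range maps $s,r$, such that each level $\mathrm{Br}_n$ is finite, $\mathrm{Br}_0=\{v_0\}$, arrows emitted from $\mathrm{Br}_n$ end in $\mathrm{Br}_{n+1}$, every vertex emits at least one and at most finitely many arrows, and $v_0$ is the only source. Let $C^*(\mathrm{Br})$ be the universal C*-algebra generated by mutually orthogonal projections $P_v$ ($v\in \mathrm{Br}_V$) and partial isometries $S_a$ ($a\in \mathrm{Br}_{Ar}$) with $S_a^*S_a=P_{r(a)}$ and $P_v=\sum_{s(a)=v}S_aS_a^*$. For a path $\mu=a_1a_2\cdots a_n$ put $S_\mu=S_{a_1}S_{a_2}\cdots S_{a_n}$, with $S_{v_0}=P_{v_0}$ for the path $v_0$ of length $0$. Let $AF(\mathrm{Br})=P_{v_0}C^*(\mathrm{Br})P_{v_0}$ be the AF algebra of $\mathrm{Br}$, i.e. the closed span of the elements $S_\mu S_{\mu'}^*$, where $\mu,\mu'$ are paths of equal length from $v_0$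 with the same range; its unit is $1=P_{v_0}$. Let $F:\mathrm{Br}_{Ar}\to\mathbb R$ be a function (a potential), and let $\alpha^F$ be the generalized gauge action, i.e. the restriction to $AF(\mathrm{Br})$ of the continuous one-parameter group of automorphisms of $C^*(\mathrm{Br})$ with $\alpha^F_t(S_a)=e^{itF(a)}S_a$ and $\alpha^F_t(P_v)=P_v$. Let $\beta\in\mathbb R$. A positive $\beta$-KMS functional is a positive linear functional $\omega$ on $AF(\mathrm{Br})$ with $\omega(ab)=\omega(b\,\alpha^F_{i\beta}(a))$ for all $\alpha^F$-analytic $a,b$ (elements whose orbit $t\mapsto\alpha^F_t(a)$ extends to an entire function $z\mapsto\alpha^F_z(a)$). Let $S^F_\beta$ be the set of $\beta$-KMS states, i.e. those with $\omega(1)=1$, and $\mathbb R^+S^F_\beta=\{t\nu : t\ge 0,\ \nu\in S^F_\beta\}$, with the weak* topology. For $j\ge1$ and $(v,w)\in \mathrm{Br}_{j-1}\times \mathrm{Br}_j$ set $$A^{(j)}(\beta)_{v,w}=\sum_{a\in s^{-1}(v)\cap r^{-1}(w)}e^{-\beta F(a)},$$ and let $\varprojlim_j A^{(j)}(\beta)$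 be the set of sequences $(\psi^j)_{j\ge0}\in\prod_{j\ge0}[0,\infty)^{\mathrm{Br}_j}$ with $\psi^{j-1}=A^{(j)}(\beta)\psi^j$ for all $j\ge1$, with the product topology. **Proposition 3.4.** For every Bratteli diagram $\mathrm{Br}$, every potential $F$ and every $\beta\in\mathbb R$, the set $\mathbb R^+S^F_\beta$ is the set of all positive $\beta$-KMS functionals for $\alpha^F$ on $AF(\mathrm{Br})$, and there is an affine homeomorphism from $\mathbb R^+S^F_\beta$ onto $\varprojlim_jA^{(j)}(\beta)$ which maps $S^F_\beta$ onto $\{(\psi^j)_{j\ge0}\in\varprojlim_jA^{(j)}(\beta) : \psi^0_{v_0}=1\}$. -/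

import Mathlib

open scoped ENNReal

universe u

/-! ## Directed graphs and their C*-algebras -/

/-- A directed graph (multiple arrows allowed) that is row-finite and has no sinks. -/
structure RowFiniteGraph where
  /-- vertices -/
  V : Type u
  /-- arrows -/
  Ar : Type u
  /-- source -/
  s : Ar → V
  /-- range -/
  r : Ar → V
  finite_out : ∀ v, {a | s a = v}.Finite
  no_sink : ∀ v, ∃ a, s a = v

namespace RowFiniteGraph

/-- The finite set `s⁻¹(v)` of arrows emitted from `v`. -/
noncomputable def out (G : RowFiniteGraph.{u}) (v : G.V) : Finset G.Ar :=
  (G.finite_out v).toFinset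

/-- A family of elements `S_a`, `P_v` of a C*-algebra satisfying the defining relations of the
graph C*-algebra: the `P_v` are mutually orthogonal projections, `S_a* S_a = P_{r(a)}` (so that
`S_a` is a partial isometry) and `P_v = ∑_{s(a) = v} S_a S_a*`. -/
structure Family (G : RowFiniteGraph.{u}) (B : Type*) [NonUnitalCStarAlgebra B] where
  S : G.Ar → B
  P : G.V → B
  proj : ∀ v, IsStarProjection (P v)
  orth : ∀ v w, v ≠ w → P v * P w = 0
  star_mul_self : ∀ a, star (S a) * S a = P (G.r a)
  sum_out : ∀ v, P v = ∑ a ∈ G.out v, S a * star (S a)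

namespace Family

variable {G : RowFiniteGraph.{u}} {B : Type*} [NonUnitalCStarAlgebra B]

theorem norm_P_le (f : G.Family B) (v : G.V) : ‖f.P v‖ ≤ 1 := by
  have h := CStarRing.norm_star_mul_self (x := f.P v)
  rw [(f.proj v).isSelfAdjoint.star_eq, (f.proj v).isIdempotentElem.eq] at h
  by_contra! hc
  nlinarith

theorem norm_S_le (f : G.Family B) (a : G.Ar) : ‖f.S a‖ ≤ 1 := by
  have h := CStarRing.norm_star_mul_self (x := f.S a)
  rw [f.star_mul_self] at h
  have := f.norm_P_le (G.r a)
  by_contra! hc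
  nlinarith

/-- The family `e^{i t F(a)} S_a`, `P_v`. -/
noncomputable def twist (f : G.Family B) (F : G.Ar → ℝ) (t : ℝ) : G.Family B where
  S a := Complex.exp (Complex.I * t * F a) • f.S a
  P := f.P
  proj := f.proj
  orth := f.orth
  star_mul_self a := by
    rw [star_smul, smul_mul_smul_comm, f.star_mul_self, Complex.star_def, ← Complex.exp_conj,
      ← Complex.exp_add]
    simp
  sum_out v := by
    rw [f.sum_out v]
    refine Finset.sum_congr rfl fun a _ => ?_
    rw [star_smul, smul_mul_smul_comm, Complex.star_def, ← Complex.exp_conj, ← Complex.exp_add]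
    simp

theorem twist_zero (f : G.Family B) (F : G.Ar → ℝ) : f.twist F 0 = f := by
  cases f; simp [twist]

theorem twist_add (f : G.Family B) (F : G.Ar → ℝ) (t t' : ℝ) :
    f.twist F (t + t') = (f.twist F t').twist F t := by
  cases f
  simp only [twist, smul_smul, ← Complex.exp_add, Family.mk.injEq, and_true]
  funext a
  congr 2
  push_cast
  ring

/-- The element `S_μ = S_{a₁} S_{a₂} ⋯ S_{aₙ}` of a path `μ = a₁ a₂ ⋯ aₙ` emitted from `v`, which
is `P_v` for the path of length `0`. (For a path of positive length `P_v S_{a₁} = S_{a₁}`.) -/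
def pathElem (f : G.Family B) (v : G.V) (μ : List G.Ar) : B :=
  μ.foldl (fun x a => x * f.S a) (f.P v)

theorem P_mul_pathElem (f : G.Family B) (v : G.V) (μ : List G.Ar) :
    f.P v * f.pathElem v μ = f.pathElem v μ := by
  have key : ∀ (l : List G.Ar) (p y : B),
      p * l.foldl (fun x a => x * f.S a) y = l.foldl (fun x a => x * f.S a) (p * y) := by
    intro l
    induction l with
    | nil => intros; rfl
    | cons a l ih => intro p y; simp only [List.foldl_cons, ih, mul_assoc]
  rw [pathElem, key, (f.proj v).isIdempotentElem.eq]

end Family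

/-- A family of generators in some C*-algebra. -/
structure Rep (G : RowFiniteGraph.{u}) where
  B : Type u
  [inst : NonUnitalCStarAlgebra B]
  fam : G.Family B

attribute [instance] Rep.inst

/-- The generator `S_a` in the product of all `C*`-algebras with a distinguished family. -/
noncomputable def prodS (G : RowFiniteGraph.{u}) (a : G.Ar) : lp (fun π : G.Rep => π.B) ∞ :=
  ⟨fun π => π.fam.S a, memℓp_infty ⟨1, by rintro _ ⟨π, rfl⟩; exact π.fam.norm_S_le a⟩⟩

/-- The generator `P_v` in the product of all `C*`-algebras with a distinguished family. -/
noncomputable def prodP (G : RowFiniteGraph.{u}) (v : G.V) : lp (fun π : G.Rep => π.B) ∞ :=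
  ⟨fun π => π.fam.P v, memℓp_infty ⟨1, by rintro _ ⟨π, rfl⟩; exact π.fam.norm_P_le v⟩⟩

/-- The closed *-subalgebra of the product generated by the `S_a` and the `P_v`. -/
noncomputable def graphSubalgebra (G : RowFiniteGraph.{u}) :
    NonUnitalStarSubalgebra ℂ (lp (fun π : G.Rep => π.B) ∞) :=
  (NonUnitalStarAlgebra.adjoin ℂ (Set.range G.prodS ∪ Set.range G.prodP)).topologicalClosure

/-- The graph C*-algebra `C*(G)`: the universal C*-algebra generated by a family `S_a`, `P_v` with
the defining relations. It is realized as the C*-subalgebra generated by the canonical elements of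
the `ℓ^∞`-product over all such families (in C*-algebras of the universe of the graph, which is
enough since a C*-algebra generated by such a family is not larger than that universe allows); the
universal homomorphism to a given family is the evaluation at that family. -/
def CStar (G : RowFiniteGraph.{u}) : Type (u + 1) := ↥G.graphSubalgebra

noncomputable instance (G : RowFiniteGraph.{u}) : NonUnitalCStarAlgebra G.CStar :=
  NonUnitalStarSubalgebra.nonUnitalCStarAlgebra G.graphSubalgebra
    (h_closed := NonUnitalStarSubalgebra.isClosed_topologicalClosure _)

/-- Evaluation at a given family: the universal homomorphism from `C*(G)`. -/
noncomputable def eval (G : RowFiniteGraph.{u}) (π : G.Rep) : G.CStar →⋆ₙₐ[ℂ] π.B where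
  toFun x := x.1 π
  map_smul' _ _ := rfl
  map_zero' := rfl
  map_add' _ _ := rfl
  map_mul' _ _ := rfl
  map_star' _ := rfl

theorem ext_eval {G : RowFiniteGraph.{u}} {x y : G.CStar} (h : ∀ π, G.eval π x = G.eval π y) :
    x = y :=
  Subtype.ext (lp.ext (funext h))

/-- The canonical generators `S_a`, `P_v` of `C*(G)`. -/
noncomputable def gen (G : RowFiniteGraph.{u}) : G.Family G.CStar where
  S a := ⟨G.prodS a, NonUnitalStarSubalgebra.le_topologicalClosure _
    (NonUnitalStarAlgebra.subset_adjoin ℂ _ (Or.inl ⟨a, rfl⟩))⟩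
  P v := ⟨G.prodP v, NonUnitalStarSubalgebra.le_topologicalClosure _
    (NonUnitalStarAlgebra.subset_adjoin ℂ _ (Or.inr ⟨v, rfl⟩))⟩
  proj v := ⟨ext_eval fun π => (π.fam.proj v).isIdempotentElem,
    ext_eval fun π => (π.fam.proj v).isSelfAdjoint⟩
  orth v w h := ext_eval fun π => π.fam.orth v w h
  star_mul_self a := ext_eval fun π => π.fam.star_mul_self a
  sum_out v := by
    refine ext_eval fun π => ?_
    rw [map_sum]
    exact π.fam.sum_out v

theorem eval_gen_S (G : RowFiniteGraph.{u}) (π : G.Rep) (a : G.Ar) :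
    G.eval π (G.gen.S a) = π.fam.S a := rfl

theorem eval_gen_P (G : RowFiniteGraph.{u}) (π : G.Rep) (v : G.V) :
    G.eval π (G.gen.P v) = π.fam.P v := rfl

/-- A property of elements of `C*(G)` that defines a closed *-subalgebra and holds for the
generators holds everywhere. -/
theorem mem_of_gen_mem {G : RowFiniteGraph.{u}} (T : NonUnitalStarSubalgebra ℂ G.CStar)
    (hT : IsClosed (T : Set G.CStar)) (hS : ∀ a, G.gen.S a ∈ T) (hP : ∀ v, G.gen.P v ∈ T)
    (x : G.CStar) : x ∈ T := by
  obtain ⟨x, hx⟩ := x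
  let N : NonUnitalStarSubalgebra ℂ (lp (fun π : G.Rep => π.B) ∞) :=
    NonUnitalStarAlgebra.adjoin ℂ (Set.range G.prodS ∪ Set.range G.prodP)
  have hN : N ≤ G.graphSubalgebra := NonUnitalStarSubalgebra.le_topologicalClosure _
  have h1 : ∀ y (hy : y ∈ N), (⟨y, hN hy⟩ : G.CStar) ∈ T := by
    intro y hy
    induction hy using NonUnitalStarAlgebra.adjoin_induction with
    | mem y hy =>
      rcases hy with ⟨a, rfl⟩ | ⟨v, rfl⟩
      · exact hS a
      · exact hP v
    | add y z hy hz h1 h2 => exact T.add_mem h1 h2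
    | zero => exact T.zero_mem
    | mul y z hy hz h1 h2 => exact T.mul_mem h1 h2
    | smul c y hy h => exact T.smul_mem' c h
    | star y hy h => exact T.star_mem' h
  have h2 : x ∈ closure (N : Set (lp (fun π : G.Rep => π.B) ∞)) := hx
  obtain ⟨y, hy, hyx⟩ := mem_closure_iff_seq_limit.1 h2
  refine hT.mem_of_tendsto (x := (⟨x, hx⟩ : G.CStar)) (f := fun n => (⟨y n, hN (hy n)⟩ : G.CStar))
    (b := Filter.atTop) ?_ (Filter.Eventually.of_forall fun n => h1 _ (hy n))
  exact tendsto_subtype_rng.2 hyx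

end RowFiniteGraph

/-! ## One-parameter groups and KMS functionals -/

/-- A continuous one-parameter group of automorphisms of a C*-algebra. -/
structure OneParameterGroup (A : Type*) [NonUnitalCStarAlgebra A] where
  hom : ℝ → A →⋆ₙₐ[ℂ] A
  hom_zero : ∀ a, hom 0 a = a
  hom_add : ∀ t t' a, hom (t + t') a = hom t (hom t' a)
  continuous_orbit : ∀ a, Continuous fun t => hom t a

namespace OneParameterGroup

/-- `f` is the entire extension `z ↦ α_z(a)` of the orbit `t ↦ α_t(a)`. Such an `f` is unique. -/
def IsEntireExtension {A : Type*} [NonUnitalCStarAlgebra A] (α : OneParameterGroup A) (a : A)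
    (f : ℂ → A) : Prop :=
  Differentiable ℂ f ∧ ∀ t : ℝ, f t = α.hom t a

/-- `a` is (entire) analytic for `α`. -/
def IsAnalytic {A : Type*} [NonUnitalCStarAlgebra A] (α : OneParameterGroup A) (a : A) : Prop :=
  ∃ f, α.IsEntireExtension a f

/-- The KMS condition `ω(ab) = ω(b α_{iβ}(a))` for all `α`-analytic `a`, `b`. -/
def KMSCondition {A : Type*} [CStarAlgebra A] (α : OneParameterGroup A) (β : ℝ)
    (ω : WeakDual ℂ A) : Prop :=
  ∀ (a b : A) (f : ℂ → A), α.IsEntireExtension a f → α.IsAnalytic b →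
    ω (a * b) = ω (b * f (Complex.I * β))

/-- Positivity of a linear functional: `ω(a* a)` is a non-negative real number for all `a`. -/
def IsPositive {A : Type*} [CStarAlgebra A] (ω : WeakDual ℂ A) : Prop :=
  ∀ a : A, ∃ c : ℝ, 0 ≤ c ∧ ω (star a * a) = c

/-- The positive `β`-KMS functionals. (Positive functionals are automatically bounded.) -/
def positiveKMS {A : Type*} [CStarAlgebra A] (α : OneParameterGroup A) (β : ℝ) :
    Set (WeakDual ℂ A) :=
  {ω | IsPositive ω ∧ α.KMSCondition β ω}

/-- The set `S_β^α` of `β`-KMS states. -/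
def kmsStates {A : Type*} [CStarAlgebra A] (α : OneParameterGroup A) (β : ℝ) :
    Set (WeakDual ℂ A) :=
  {ω | IsPositive ω ∧ ω 1 = 1 ∧ α.KMSCondition β ω}

/-- The cone `ℝ⁺ S_β^α = {t ν : t ≥ 0, ν ∈ S_β^α}`, with the weak* topology. -/
def kmsCone {A : Type*} [CStarAlgebra A] (α : OneParameterGroup A) (β : ℝ) :
    Set (WeakDual ℂ A) :=
  {ω | ∃ t : ℝ, 0 ≤ t ∧ ∃ ν ∈ α.kmsStates β, ω = t • ν}

end OneParameterGroup

namespace RowFiniteGraph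

/-- The action on the product that precomposes with the twisting of families. -/
noncomputable def prodTwist (G : RowFiniteGraph.{u}) (F : G.Ar → ℝ) (t : ℝ) :
    lp (fun π : G.Rep => π.B) ∞ →⋆ₙₐ[ℂ] lp (fun π : G.Rep => π.B) ∞ where
  toFun x := ⟨fun π => x ⟨π.B, π.fam.twist F t⟩, memℓp_infty ⟨‖x‖, by
    rintro _ ⟨π, rfl⟩
    exact lp.norm_apply_le_norm ENNReal.top_ne_zero x (⟨π.B, π.fam.twist F t⟩ : G.Rep)⟩⟩
  map_smul' _ _ := rfl
  map_zero' := rfl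
  map_add' _ _ := rfl
  map_mul' _ _ := rfl
  map_star' _ := rfl

theorem prodTwist_mem (G : RowFiniteGraph.{u}) (F : G.Ar → ℝ) (t : ℝ) (x : G.CStar) :
    G.prodTwist F t x.1 ∈ G.graphSubalgebra := by
  have hcont : Continuous (G.prodTwist F t) := by
    refine AddMonoidHomClass.continuous_of_bound (G.prodTwist F t) 1 fun x => ?_
    rw [one_mul]
    exact lp.norm_le_of_forall_le (norm_nonneg _) fun π =>
      lp.norm_apply_le_norm ENNReal.top_ne_zero x (⟨π.B, π.fam.twist F t⟩ : G.Rep)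
  let T : NonUnitalStarSubalgebra ℂ G.CStar :=
    { carrier := {x | G.prodTwist F t x.1 ∈ G.graphSubalgebra}
      add_mem' := fun {x y} hx hy => G.graphSubalgebra.add_mem hx hy
      zero_mem' := G.graphSubalgebra.zero_mem
      mul_mem' := fun {x y} hx hy => G.graphSubalgebra.mul_mem hx hy
      smul_mem' := fun c x hx => SMulMemClass.smul_mem (s := G.graphSubalgebra) c hx
      star_mem' := fun {x} hx => G.graphSubalgebra.star_mem' hx }
  refine mem_of_gen_mem T ?_ (fun a => ?_) (fun v => ?_) x
  · have : IsClosed (G.graphSubalgebra : Set (lp (fun π : G.Rep => π.B) ∞)) :=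
      NonUnitalStarSubalgebra.isClosed_topologicalClosure _
    exact this.preimage (hcont.comp continuous_subtype_val)
  · exact SMulMemClass.smul_mem (s := G.graphSubalgebra) (Complex.exp (Complex.I * t * F a))
      (G.gen.S a).2
  · exact (G.gen.P v).2

/-- The automorphism `α^F_t` of `C*(G)`. -/
noncomputable def gaugeHom (G : RowFiniteGraph.{u}) (F : G.Ar → ℝ) (t : ℝ) :
    G.CStar →⋆ₙₐ[ℂ] G.CStar where
  toFun x := ⟨G.prodTwist F t x.1, G.prodTwist_mem F t x⟩
  map_smul' _ _ := rfl
  map_zero' := rfl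
  map_add' _ _ := rfl
  map_mul' _ _ := rfl
  map_star' _ := rfl

theorem gaugeHom_S (G : RowFiniteGraph.{u}) (F : G.Ar → ℝ) (t : ℝ) (a : G.Ar) :
    G.gaugeHom F t (G.gen.S a) = Complex.exp (Complex.I * t * F a) • G.gen.S a := rfl

theorem gaugeHom_P (G : RowFiniteGraph.{u}) (F : G.Ar → ℝ) (t : ℝ) (v : G.V) :
    G.gaugeHom F t (G.gen.P v) = G.gen.P v := rfl

theorem norm_gaugeHom_le (G : RowFiniteGraph.{u}) (F : G.Ar → ℝ) (t : ℝ) (x : G.CStar) :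
    ‖G.gaugeHom F t x‖ ≤ ‖x‖ :=
  lp.norm_le_of_forall_le (norm_nonneg _) fun π =>
    lp.norm_apply_le_norm ENNReal.top_ne_zero x.1 (⟨π.B, π.fam.twist F t⟩ : G.Rep)

/-- The generalized gauge action `α^F` on `C*(G)`, determined by `α^F_t(S_a) = e^{i t F(a)} S_a` and
`α^F_t(P_v) = P_v`. -/
noncomputable def gaugeAction (G : RowFiniteGraph.{u}) (F : G.Ar → ℝ) :
    OneParameterGroup G.CStar where
  hom := G.gaugeHom F
  hom_zero x := ext_eval fun π => by
    change x.1 ⟨π.B, π.fam.twist F 0⟩ = x.1 π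
    rw [Family.twist_zero]
  hom_add t t' x := ext_eval fun π => by
    change x.1 ⟨π.B, π.fam.twist F (t + t')⟩ = x.1 ⟨π.B, (π.fam.twist F t).twist F t'⟩
    rw [add_comm t t', Family.twist_add]
  continuous_orbit := by
    let T : NonUnitalStarSubalgebra ℂ G.CStar :=
      { carrier := {x | Continuous fun t => G.gaugeHom F t x}
        add_mem' := fun {x y} hx hy => by
          change Continuous fun t => G.gaugeHom F t (x + y)
          simp only [map_add]
          exact Continuous.add hx hy
        zero_mem' := by
          change Continuous fun t => G.gaugeHom F t 0
          simp only [map_zero]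
          exact continuous_const
        mul_mem' := fun {x y} hx hy => by
          change Continuous fun t => G.gaugeHom F t (x * y)
          simp only [map_mul]
          exact Continuous.mul hx hy
        smul_mem' := fun c x hx => by
          change Continuous fun t => G.gaugeHom F t (c • x)
          simp only [map_smul]
          exact Continuous.const_smul hx c
        star_mem' := fun {x} hx => by
          change Continuous fun t => G.gaugeHom F t (star x)
          simp only [map_star]
          exact Continuous.star hx }
    refine mem_of_gen_mem T ?_ (fun a => ?_) (fun v => ?_)
    · refine isClosed_of_closure_subset fun x hx => ?_
      obtain ⟨y, hy, hyx⟩ := mem_closure_iff_seq_limit.1 hx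
      refine continuous_of_uniform_approx_of_continuous fun U hU => ?_
      obtain ⟨ε, hε, hεU⟩ := Metric.mem_uniformity_dist.1 hU
      obtain ⟨n, hn⟩ := (Metric.tendsto_atTop.1 hyx ε hε)
      refine ⟨fun t => G.gaugeHom F t (y n), hy n, fun t => hεU ?_⟩
      rw [dist_eq_norm, ← map_sub]
      refine (G.norm_gaugeHom_le F t _).trans_lt ?_
      rw [← dist_eq_norm, dist_comm]
      exact hn n le_rfl
    · change Continuous fun t : ℝ => Complex.exp (Complex.I * t * F a) • G.gen.S a
      fun_prop
    · change Continuous fun _ : ℝ => G.gen.P v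
      exact continuous_const

end RowFiniteGraph

/-! ## Bratteli diagrams, AF algebras -/

/-- A Bratteli diagram: the vertex set is partitioned into finite levels, level `0` consists of the
top vertex only, arrows go from each level to the next one, every vertex emits at least one and at
most finitely many arrows and the top vertex is the only source. -/
structure BratteliDiagram extends RowFiniteGraph.{u} where
  /-- the number of the level of a vertex -/
  level : V → ℕ
  finite_level : ∀ n, {v | level v = n}.Finite
  /-- the top vertex -/
  top : V
  level_eq_zero : ∀ v, level v = 0 ↔ v = top
  level_range : ∀ a, level (r a) = level (s a) + 1
  only_source : ∀ v, v ≠ top → ∃ a, r a = v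

namespace RowFiniteGraph

/-- `G.IsPath v μ w`: the list of arrows `μ` is a path with source `v` and range `w`. -/
def IsPath (G : RowFiniteGraph.{u}) : G.V → List G.Ar → G.V → Prop
  | v, [], w => v = w
  | v, a :: μ, w => G.s a = v ∧ G.IsPath (G.r a) μ w

theorem gaugeHom_pathElem (G : RowFiniteGraph.{u}) (F : G.Ar → ℝ) (t : ℝ) (v : G.V)
    (μ : List G.Ar) : ∃ c : ℂ, G.gaugeHom F t (G.gen.pathElem v μ) = c • G.gen.pathElem v μ := by
  have key : ∀ (l : List G.Ar) (y : G.CStar) (c : ℂ), G.gaugeHom F t y = c • y →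
      ∃ d : ℂ, G.gaugeHom F t (l.foldl (fun x a => x * G.gen.S a) y) =
        d • l.foldl (fun x a => x * G.gen.S a) y := by
    intro l
    induction l with
    | nil => intro y c h; exact ⟨c, h⟩
    | cons a l ih =>
      intro y c h
      refine ih (y * G.gen.S a) (c * Complex.exp (Complex.I * t * F a)) ?_
      rw [map_mul, h, gaugeHom_S, smul_mul_smul_comm]
  exact key μ (G.gen.P v) 1 (by rw [gaugeHom_P, one_smul])

end RowFiniteGraph

namespace BratteliDiagram

/-- The matrix units `E^n_{μ,μ'} = S_μ S_{μ'}*`, where `μ`, `μ'` run over the pairs of paths of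
length `n` from the top vertex with the same range. -/
def matrixUnits (Br : BratteliDiagram.{u}) (n : ℕ) : Set Br.CStar :=
  {x | ∃ (μ μ' : List Br.Ar) (w : Br.V), Br.IsPath Br.top μ w ∧ Br.IsPath Br.top μ' w ∧
    μ.length = n ∧ μ'.length = n ∧
    x = Br.gen.pathElem Br.top μ * star (Br.gen.pathElem Br.top μ')}

/-- The C*-subalgebra of `C*(Br)` generated by the matrix units `E^n_{μ,μ'}`, i.e. the closure of
the union of the finite dimensional algebras `𝔽_n` that they span. -/
noncomputable def afSubalgebra (Br : BratteliDiagram.{u}) : NonUnitalStarSubalgebra ℂ Br.CStar :=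
  (NonUnitalStarAlgebra.adjoin ℂ (⋃ n, Br.matrixUnits n)).topologicalClosure

theorem mem_of_matrixUnits_subset {Br : BratteliDiagram.{u}}
    (T : NonUnitalStarSubalgebra ℂ Br.CStar) (hT : IsClosed (T : Set Br.CStar))
    (h : ∀ n, Br.matrixUnits n ⊆ T) : Br.afSubalgebra ≤ T :=
  NonUnitalStarSubalgebra.topologicalClosure_minimal _
    (NonUnitalStarAlgebra.adjoin_le (Set.iUnion_subset h)) hT

theorem matrixUnits_subset (Br : BratteliDiagram.{u}) (n : ℕ) :
    Br.matrixUnits n ⊆ Br.afSubalgebra := fun _ hx =>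
  NonUnitalStarSubalgebra.le_topologicalClosure _
    (NonUnitalStarAlgebra.subset_adjoin ℂ _ (Set.mem_iUnion.2 ⟨n, hx⟩))

theorem P_top_mem (Br : BratteliDiagram.{u}) : Br.gen.P Br.top ∈ Br.afSubalgebra :=
  Br.matrixUnits_subset 0 ⟨[], [], Br.top, rfl, rfl, rfl, rfl, by
    change Br.gen.P Br.top = Br.gen.P Br.top * star (Br.gen.P Br.top)
    rw [(Br.gen.proj Br.top).isSelfAdjoint.star_eq, (Br.gen.proj Br.top).isIdempotentElem.eq]⟩

theorem P_top_unit (Br : BratteliDiagram.{u}) {x : Br.CStar} (hx : x ∈ Br.afSubalgebra) :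
    Br.gen.P Br.top * x = x ∧ x * Br.gen.P Br.top = x := by
  let p := Br.gen.P Br.top
  have hp : star p = p := (Br.gen.proj Br.top).isSelfAdjoint.star_eq
  let T : NonUnitalStarSubalgebra ℂ Br.CStar :=
    { carrier := {x | p * x = x ∧ x * p = x}
      add_mem' := fun {x y} hx hy =>
        ⟨by rw [mul_add, hx.1, hy.1], by rw [add_mul, hx.2, hy.2]⟩
      zero_mem' := ⟨mul_zero _, zero_mul _⟩
      mul_mem' := fun {x y} hx hy => ⟨by rw [← mul_assoc, hx.1], by rw [mul_assoc, hy.2]⟩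
      smul_mem' := fun c x hx => ⟨by rw [mul_smul_comm, hx.1], by rw [smul_mul_assoc, hx.2]⟩
      star_mem' := fun {x} hx =>
        ⟨by simpa [hp] using congrArg star hx.2, by simpa [hp] using congrArg star hx.1⟩ }
  refine mem_of_matrixUnits_subset T ?_ ?_ hx
  · exact (isClosed_eq (by fun_prop) (by fun_prop)).inter
      (isClosed_eq (by fun_prop) (by fun_prop))
  · rintro n _ ⟨μ, μ', w, -, -, -, -, rfl⟩
    have h1 := Br.gen.P_mul_pathElem Br.top μ
    have h2 := congrArg star (Br.gen.P_mul_pathElem Br.top μ')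
    rw [star_mul, hp] at h2
    exact ⟨by rw [← mul_assoc, h1], by rw [mul_assoc, h2]⟩

/-- The AF algebra `AF(Br)` of a Bratteli diagram, realized in the graph C*-algebra as
`P_{v₀} C*(Br) P_{v₀}`, the closure of the union of the tower `ℂ ⊆ 𝔽_1 ⊆ 𝔽_2 ⊆ ⋯`. -/
def AF (Br : BratteliDiagram.{u}) : Type (u + 1) := ↥Br.afSubalgebra

/-- `AF(Br)` is a C*-algebra with unit `P_{v₀}`. -/
noncomputable instance (Br : BratteliDiagram.{u}) : CStarAlgebra Br.AF :=
  let I : NonUnitalCStarAlgebra Br.AF :=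
    NonUnitalStarSubalgebra.nonUnitalCStarAlgebra Br.afSubalgebra
      (h_closed := NonUnitalStarSubalgebra.isClosed_topologicalClosure _)
  let R : NormedRing Br.AF :=
    { I.toNonUnitalNormedRing with
      one := (⟨Br.gen.P Br.top, Br.P_top_mem⟩ : ↥Br.afSubalgebra)
      one_mul := fun x => Subtype.ext (Br.P_top_unit x.2).1
      mul_one := fun x => Subtype.ext (Br.P_top_unit x.2).2 }
  { R, I with
    toNormedAlgebra := { Algebra.ofModule smul_mul_assoc mul_smul_comm with
      norm_smul_le := I.toNormedSpace.norm_smul_le } }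

theorem gaugeHom_mem (Br : BratteliDiagram.{u}) (F : Br.Ar → ℝ) (t : ℝ) {x : Br.CStar}
    (hx : x ∈ Br.afSubalgebra) : Br.gaugeHom F t x ∈ Br.afSubalgebra := by
  let T : NonUnitalStarSubalgebra ℂ Br.CStar := Br.afSubalgebra.comap (Br.gaugeHom F t)
  refine mem_of_matrixUnits_subset T ?_ ?_ hx
  · have hcl : IsClosed (Br.afSubalgebra : Set Br.CStar) :=
      NonUnitalStarSubalgebra.isClosed_topologicalClosure _
    refine hcl.preimage (AddMonoidHomClass.continuous_of_bound (Br.gaugeHom F t) 1 fun x => ?_)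
    rw [one_mul]
    exact Br.norm_gaugeHom_le F t x
  · rintro n _ ⟨μ, μ', w, h1, h2, h3, h4, rfl⟩
    obtain ⟨c, hc⟩ := Br.gaugeHom_pathElem F t Br.top μ
    obtain ⟨d, hd⟩ := Br.gaugeHom_pathElem F t Br.top μ'
    change Br.gaugeHom F t _ ∈ Br.afSubalgebra
    rw [map_mul, map_star, hc, hd, star_smul, smul_mul_smul_comm]
    exact SMulMemClass.smul_mem _ (Br.matrixUnits_subset n ⟨μ, μ', w, h1, h2, h3, h4, rfl⟩)

/-- The restriction to `AF(Br)` of the generalized gauge action `α^F` on `C*(Br)`. -/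
noncomputable def gaugeActionAF (Br : BratteliDiagram.{u}) (F : Br.Ar → ℝ) :
    OneParameterGroup Br.AF where
  hom t :=
    { toFun := fun x => (⟨(Br.gaugeAction F).hom t x.1, Br.gaugeHom_mem F t x.2⟩ :
        ↥Br.afSubalgebra)
      map_smul' := fun c x => Subtype.ext (map_smul (Br.gaugeHom F t) c x.1)
      map_zero' := Subtype.ext (map_zero (Br.gaugeHom F t))
      map_add' := fun x y => Subtype.ext (map_add (Br.gaugeHom F t) x.1 y.1)
      map_mul' := fun x y => Subtype.ext (map_mul (Br.gaugeHom F t) x.1 y.1)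
      map_star' := fun x => Subtype.ext (map_star (Br.gaugeHom F t) x.1) }
  hom_zero x := Subtype.ext ((Br.gaugeAction F).hom_zero x.1)
  hom_add t t' x := Subtype.ext ((Br.gaugeAction F).hom_add t t' x.1)
  continuous_orbit x := Continuous.subtype_mk ((Br.gaugeAction F).continuous_orbit x.1)
    fun t => Br.gaugeHom_mem F t x.2

/-! ## Projective matrix systems -/

/-- The `n`-th level of a Bratteli diagram. -/
abbrev Level (Br : BratteliDiagram.{u}) (n : ℕ) : Type u := {v : Br.V // Br.level v = n}

noncomputable instance (Br : BratteliDiagram.{u}) (n : ℕ) : Fintype (Br.Level n) :=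
  (Br.finite_level n).fintype

/-- The top vertex as an element of level `0`. -/
def topLevel (Br : BratteliDiagram.{u}) : Br.Level 0 := ⟨Br.top, (Br.level_eq_zero _).2 rfl⟩

open Classical in
/-- The product `A^{(1)} A^{(2)} ⋯ A^{(k)}`, where `A j` stands for `A^{(j+1)}`. -/
noncomputable def matProd (Br : BratteliDiagram.{u})
    (A : ∀ j, Matrix (Br.Level j) (Br.Level (j + 1)) ℝ) : ∀ k, Matrix (Br.Level 0) (Br.Level k) ℝ
  | 0 => 1
  | k + 1 => Br.matProd A k * A k

/-- A projective matrix system over `Br`: non-negative matrices `A^{(j)}` over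
`Br_{j-1} × Br_j`, `j ≥ 1`, such that `(A^{(1)} ⋯ A^{(k)})_{v₀,w} ≠ 0` for all `k ≥ 1` and
`w ∈ Br_k`. Here `A j` stands for `A^{(j+1)}`. -/
structure ProjectiveMatrixSystem (Br : BratteliDiagram.{u}) where
  A : ∀ j, Matrix (Br.Level j) (Br.Level (j + 1)) ℝ
  nonneg : ∀ j v w, 0 ≤ A j v w
  prod_ne_zero : ∀ k, 1 ≤ k → ∀ w, Br.matProd A k Br.topLevel w ≠ 0

/-- The projective limit cone `lim A^{(j)}` in `∏_j ℝ^{Br_j}` (with the product topology): all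
sequences of non-negative vectors `ψ^j` with `ψ^{j-1} = A^{(j)} ψ^j` for all `j ≥ 1`. -/
def ProjectiveMatrixSystem.limit {Br : BratteliDiagram.{u}} (M : Br.ProjectiveMatrixSystem) :
    Set (∀ j, Br.Level j → ℝ) :=
  {ψ | (∀ j v, 0 ≤ ψ j v) ∧ ∀ j, ψ j = (M.A j).mulVec (ψ (j + 1))}

open Classical in
/-- The matrix with entries `∑ e^{-β F(a)}`, the sum over all arrows `a` from `v` to `w`. -/
noncomputable def potentialMatrix (Br : BratteliDiagram.{u}) (F : Br.Ar → ℝ) (β : ℝ) (j : ℕ) :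
    Matrix (Br.Level j) (Br.Level (j + 1)) ℝ :=
  fun v w => ∑ a ∈ Br.out v with Br.r a = w, Real.exp (-β * F a)

theorem matProd_potentialMatrix_pos (Br : BratteliDiagram.{u}) (F : Br.Ar → ℝ) (β : ℝ) (k : ℕ)
    (w : Br.Level k) : 0 < Br.matProd (Br.potentialMatrix F β) k Br.topLevel w := by
  induction k with
  | zero =>
    have : w = Br.topLevel := Subtype.ext ((Br.level_eq_zero _).1 w.2)
    subst this
    simp [matProd]
  | succ k ih =>
    obtain ⟨a, ha⟩ := Br.only_source w.1 fun h => by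
      have h1 := (Br.level_eq_zero w.1).2 h
      have h2 := w.2
      omega
    have hs : Br.level (Br.s a) = k := by
      have h1 := Br.level_range a
      rw [ha, w.2] at h1
      omega
    refine Finset.sum_pos' (fun v _ => mul_nonneg (ih v).le
      (Finset.sum_nonneg fun _ _ => (Real.exp_pos _).le))
      ⟨⟨Br.s a, hs⟩, Finset.mem_univ _, mul_pos (ih _) ?_⟩
    refine Finset.sum_pos (fun _ _ => Real.exp_pos _) ⟨a, ?_⟩
    simp [RowFiniteGraph.out, ha]

/-- The projective matrix system `A^{(j)}(β)`, `j ≥ 1`, of a potential. -/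
noncomputable def potentialSystem (Br : BratteliDiagram.{u}) (F : Br.Ar → ℝ) (β : ℝ) :
    Br.ProjectiveMatrixSystem where
  A := Br.potentialMatrix F β
  nonneg _ _ _ := Finset.sum_nonneg fun _ _ => (Real.exp_pos _).le
  prod_ne_zero k _ w := (Br.matProd_potentialMatrix_pos F β k w).ne'

end BratteliDiagram

/-- The map `h` between subsets of real vector spaces is affine: it respects convex
combinations. -/
def IsAffineBetween {E E' : Type*} [AddCommMonoid E] [Module ℝ E] [AddCommMonoid E'] [Module ℝ E']
    {K : Set E} {L : Set E'} (h : K → L) : Prop :=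
  ∀ (x y z : K) (a b : ℝ), 0 ≤ a → 0 ≤ b → a + b = 1 →
    (z : E) = a • (x : E) + b • (y : E) → (h z : E') = a • (h x : E') + b • (h y : E')

/-! For paths `μ`, `ν` from the top vertex `v₀` with the same range put `E_{μν} = S_μ S_ν*`. These
matrix units span a dense subspace of `AF(Br)`, and `α^F_z` multiplies `E_{μν}` by
`e^{iz(F(μ)-F(ν))}`. On matrix units the KMS condition therefore says that `ω(E_{μν}) = 0` for `μ ≠
ν` and that `e^{βF(μ)} ω(E_{μμ})` depends only on the range of `μ`; call it `φ(r(μ))`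
(`hasVertexWeights_of_kms`). Applying `ω` to `E_{μμ} = ∑_a E_{μa,μa}` gives `φ(v) = ∑_a e^{-βF(a)}
φ(r(a))`, which, read level by level, is membership in the projective limit (`mem_limit_iff`).
Density makes `ω ↦ φ` injective.

For surjectivity let `φ ≥ 0` be harmonic. The numbers `e^{-βF(μ)} φ(r(μ))` are consistent like the
masses of cylinder sets of infinite paths. In the representation on `ℓ²` of the infinite paths, the
combination of vector states with these coefficients over the paths of length `n` is positive, has
norm at most `φ(v₀)` and has the right values on matrix units up to level `n`. A weak* limit point
has all the right values (`exists_hasVertexWeights`). Vanishing off the diagonal makes it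
`α^F`-invariant, and uniqueness of entire extensions then gives the KMS condition for all analytic
elements (`HasVertexWeights.kmsCondition`).

The weights are evaluations of `ω`, so the map is continuous and affine. The inverse is continuous
because of the bound `|ω(x)| ≤ φ(v₀)‖x‖`. A positive KMS functional is normalized by dividing by
`φ(v₀) = ω(1)`; if this is `0`, then `ω = 0`, which is `0 • ν` for a KMS state `ν`. Such a state
exists by compactness (`exists_mem_limit`). -/

/-- In a C*-algebra, a vanishing finite sum of elements `x* x` has vanishing terms. -/
theorem eq_zero_of_sum_star_mul_self_eq_zero {B : Type*} [NonUnitalCStarAlgebra B] {ι : Type*}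
    {s : Finset ι} {x : ι → B} (h : ∑ i ∈ s, star (x i) * x i = 0) {i : ι} (hi : i ∈ s) :
    x i = 0 := by
  -- The order is used only here: a sum of non-negative elements vanishes only if each of them does.
  let _ := CStarAlgebra.spectralOrder B
  have := CStarAlgebra.spectralOrderedRing B
  exact CStarRing.star_mul_self_eq_zero_iff _ |>.1
    ((Finset.sum_eq_zero_iff_of_nonneg fun j _ => star_mul_self_nonneg (x j)).1 h i hi)

/-! ### Consequences of the defining relations of a graph family -/

namespace RowFiniteGraph

@[simp] theorem mem_out {G : RowFiniteGraph.{u}} {a : G.Ar} {v : G.V} :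
    a ∈ G.out v ↔ G.s a = v := by
  simp [out]

namespace Family

variable {G : RowFiniteGraph.{u}} {B : Type*} [NonUnitalCStarAlgebra B] (f : G.Family B)

theorem star_P (v : G.V) : star (f.P v) = f.P v := (f.proj v).isSelfAdjoint.star_eq

theorem P_mul_P (v : G.V) : f.P v * f.P v = f.P v := (f.proj v).isIdempotentElem.eq

/-- If `P_{s(a)} y = 0`, then `0 = y* P_{s(a)} y = ∑_b (S_b* y)* (S_b* y)`, so each `S_b* y`
vanishes. This is applied to `y = z - P_{s(a)} z` with arbitrary `z`, since no unit is available to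
form `1 - P_{s(a)}`. -/
theorem star_S_mul_P (a : G.Ar) : star (f.S a) * f.P (G.s a) = star (f.S a) := by
  have h1 : ∀ z, star (f.S a) * (z - f.P (G.s a) * z) = 0 := by
    intro z
    set y := z - f.P (G.s a) * z with hy
    have hPy : f.P (G.s a) * y = 0 := by
      rw [hy, mul_sub, ← mul_assoc, f.P_mul_P, sub_self]
    refine eq_zero_of_sum_star_mul_self_eq_zero (s := G.out (G.s a))
      (x := fun b => star (f.S b) * y) ?_ (mem_out.2 rfl)
    have : ∑ b ∈ G.out (G.s a), star (star (f.S b) * y) * (star (f.S b) * y)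
        = star y * (f.P (G.s a) * y) := by
      rw [f.sum_out (G.s a), Finset.sum_mul, Finset.mul_sum]
      refine Finset.sum_congr rfl fun b _ => ?_
      simp [mul_assoc]
    rw [this, hPy, mul_zero]
  have h2 : ∀ z, (star (f.S a) - star (f.S a) * f.P (G.s a)) * z = 0 := by
    intro z
    rw [sub_mul, mul_assoc, ← mul_sub, h1]
  have := h2 (star (star (f.S a) - star (f.S a) * f.P (G.s a)))
  exact (sub_eq_zero.1 (CStarRing.mul_star_self_eq_zero_iff _ |>.1 this)).symm

theorem P_mul_S (a : G.Ar) : f.P (G.s a) * f.S a = f.S a := by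
  simpa [star_P] using congrArg star (f.star_S_mul_P a)

theorem S_mul_P (a : G.Ar) : f.S a * f.P (G.r a) = f.S a := by
  have h : star (f.S a - f.S a * f.P (G.r a)) * (f.S a - f.S a * f.P (G.r a)) = 0 := by
    have h1 : star (f.S a) * (f.S a - f.S a * f.P (G.r a)) = 0 := by
      rw [mul_sub, ← mul_assoc, f.star_mul_self, f.P_mul_P, sub_self]
    rw [star_sub, star_mul, sub_mul, mul_assoc, h1, mul_zero, sub_zero]
  exact (sub_eq_zero.1 (CStarRing.star_mul_self_eq_zero_iff _ |>.1 h)).symm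

/-- For a common source, `P_{r(b)} = S_b* P_{s(b)} S_b = ∑_c (S_c* S_b)* (S_c* S_b)`. The term `c =
b` already equals `P_{r(b)}`, so the others vanish. For different sources the vertex projections are
orthogonal. -/
theorem star_S_mul_S_of_ne {a b : G.Ar} (h : a ≠ b) : star (f.S a) * f.S b = 0 := by
  classical
  by_cases hs : G.s a = G.s b
  · refine eq_zero_of_sum_star_mul_self_eq_zero (s := (G.out (G.s b)).erase b)
      (x := fun c => star (f.S c) * f.S b) ?_ (by simp [h, hs])
    have h1 : ∑ c ∈ G.out (G.s b), star (star (f.S c) * f.S b) * (star (f.S c) * f.S b)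
        = f.P (G.r b) := by
      calc _ = star (f.S b) * (f.P (G.s b) * f.S b) := by
            rw [f.sum_out (G.s b), Finset.sum_mul, Finset.mul_sum]
            refine Finset.sum_congr rfl fun c _ => ?_
            simp [mul_assoc]
        _ = _ := by rw [f.P_mul_S, f.star_mul_self]
    rw [← Finset.add_sum_erase _ _ (mem_out.2 rfl : b ∈ G.out (G.s b)), f.star_mul_self,
      f.star_P, f.P_mul_P] at h1
    exact left_eq_add.1 h1.symm
  · rw [← f.P_mul_S b, ← mul_assoc, ← f.star_S_mul_P a, mul_assoc _ (f.P _) (f.P _),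
      f.orth _ _ hs, mul_zero, zero_mul]

@[simp] theorem pathElem_nil (v : G.V) : f.pathElem v [] = f.P v := rfl

theorem pathElem_append_singleton (v : G.V) (μ : List G.Ar) (a : G.Ar) :
    f.pathElem v (μ ++ [a]) = f.pathElem v μ * f.S a := by
  simp [pathElem]

end Family

theorem isPath_append_singleton {G : RowFiniteGraph.{u}} {v w : G.V} {μ : List G.Ar} {a : G.Ar} :
    G.IsPath v (μ ++ [a]) w ↔ G.IsPath v μ (G.s a) ∧ G.r a = w := by
  induction μ generalizing v with
  | nil => simp [IsPath, eq_comm]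
  | cons b μ ih => simp [IsPath, ih, and_assoc]

theorem IsPath.range_unique {G : RowFiniteGraph.{u}} {v w w' : G.V} {μ : List G.Ar}
    (h : G.IsPath v μ w) (h' : G.IsPath v μ w') : w = w' := by
  induction μ generalizing v with
  | nil => exact h.symm.trans h'
  | cons b μ ih => exact ih h.2 h'.2

namespace Family

variable {G : RowFiniteGraph.{u}} {B : Type*} [NonUnitalCStarAlgebra B] (f : G.Family B)

theorem pathElem_mul_P {v w : G.V} {μ : List G.Ar} (h : G.IsPath v μ w) :
    f.pathElem v μ * f.P w = f.pathElem v μ := by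
  rcases List.eq_nil_or_concat' μ with rfl | ⟨μ, a, rfl⟩
  · obtain rfl : v = w := h
    exact f.P_mul_P v
  · rw [isPath_append_singleton] at h
    rw [pathElem_append_singleton, mul_assoc, ← h.2, f.S_mul_P]

theorem star_pathElem_mul_pathElem_self {v w : G.V} {μ : List G.Ar} (h : G.IsPath v μ w) :
    star (f.pathElem v μ) * f.pathElem v μ = f.P w := by
  induction μ using List.reverseRecOn generalizing w with
  | nil =>
    obtain rfl : v = w := h
    rw [pathElem_nil, f.star_P, f.P_mul_P]
  | append_singleton μ a ih =>
    rw [isPath_append_singleton] at h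
    rw [pathElem_append_singleton, star_mul, mul_assoc, ← mul_assoc (star (f.pathElem v μ)),
      ih h.1, f.P_mul_S, f.star_mul_self, h.2]

theorem star_pathElem_mul_pathElem_of_ne {v w w' : G.V} {μ ν : List G.Ar} (h : G.IsPath v μ w)
    (h' : G.IsPath v ν w') (hl : μ.length = ν.length) (hne : μ ≠ ν) :
    star (f.pathElem v μ) * f.pathElem v ν = 0 := by
  induction μ using List.reverseRecOn generalizing w w' ν with
  | nil => exact absurd (List.length_eq_zero_iff.1 hl.symm).symm hne
  | append_singleton μ a ih =>
    rcases List.eq_nil_or_concat' ν with rfl | ⟨ν, b, rfl⟩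
    · simp at hl
    rw [isPath_append_singleton] at h h'
    rw [pathElem_append_singleton, pathElem_append_singleton, star_mul, mul_assoc,
      ← mul_assoc (star (f.pathElem v μ))]
    by_cases hμν : μ = ν
    · subst hμν
      rw [f.star_pathElem_mul_pathElem_self h.1, h.1.range_unique h'.1, f.P_mul_S]
      exact f.star_S_mul_S_of_ne fun hab => hne (by rw [hab])
    · rw [ih h.1 h'.1 (by simpa using hl) hμν, zero_mul, mul_zero]

/-- Inserting `P_w = ∑_a S_a S_a*` in the middle writes a matrix unit in terms of those of the next
level. -/
theorem pathElem_mul_star_eq_sum {v w : G.V} {μ ν : List G.Ar} (h : G.IsPath v μ w) :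
    f.pathElem v μ * star (f.pathElem v ν) =
      ∑ a ∈ G.out w, f.pathElem v (μ ++ [a]) * star (f.pathElem v (ν ++ [a])) := by
  nth_rw 1 [← f.pathElem_mul_P h]
  rw [f.sum_out w, Finset.mul_sum, Finset.sum_mul]
  refine Finset.sum_congr rfl fun a _ => ?_
  simp [pathElem_append_singleton, mul_assoc]

end Family

end RowFiniteGraph

/-! ### Partial isometries of `ℓ²` from partial bijections -/

namespace PEquiv

variable {X : Type*}

/-- The composite of a function with a partial bijection, extended by zero. -/
def pullback (e : X ≃. X) (f : X → ℂ) (x : X) : ℂ := (e x).elim 0 f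

theorem pullback_eq_of_eq_some {e : X ≃. X} {f : X → ℂ} {x y : X} (h : e x = some y) :
    e.pullback f x = f y := by
  simp [pullback, h]

theorem pullback_eq_of_eq_none {e : X ≃. X} {f : X → ℂ} {x : X} (h : e x = none) :
    e.pullback f x = 0 := by
  simp [pullback, h]

/-- Injectivity of `e` on its domain means that every value of `f` is used at most once. -/
theorem sum_norm_pullback_le (e : X ≃. X) (f : lp (fun _ : X => ℂ) 2) (s : Finset X) :
    ∑ x ∈ s, ‖e.pullback f x‖ ^ (2 : ℝ≥0∞).toReal ≤ ‖f‖ ^ (2 : ℝ≥0∞).toReal := by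
  classical
  have h : ∀ x, ‖e.pullback f x‖ ^ (2 : ℝ≥0∞).toReal
      = ∑ y ∈ (e x).toFinset, ‖f y‖ ^ (2 : ℝ≥0∞).toReal := by
    intro x
    cases h : e x with
    | none => simp [pullback_eq_of_eq_none h]
    | some y => simp [pullback_eq_of_eq_some h]
  simp_rw [h]
  rw [← Finset.sum_biUnion]
  · exact lp.sum_rpow_le_norm_rpow (by norm_num) f _
  · intro x _ x' _ hxx'
    refine Finset.disjoint_left.2 fun y hy hy' => hxx' ?_
    exact e.inj (Option.mem_toFinset.1 hy) (Option.mem_toFinset.1 hy')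

/-- The partial isometry of `ℓ²(X)` given by a partial bijection of `X`. -/
noncomputable def toL2 (e : X ≃. X) : lp (fun _ : X => ℂ) 2 →L[ℂ] lp (fun _ : X => ℂ) 2 :=
  LinearMap.mkContinuous
    { toFun := fun f => ⟨e.pullback f, memℓp_gen' (e.sum_norm_pullback_le f)⟩
      map_add' := fun f g => lp.ext <| funext fun x => by
        change e.pullback (f + g : lp (fun _ : X => ℂ) 2) x = e.pullback f x + e.pullback g x
        cases h : e x with
        | none => simp only [pullback_eq_of_eq_none h, add_zero]
        | some y => simp only [pullback_eq_of_eq_some h]; rfl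
      map_smul' := fun c f => lp.ext <| funext fun x => by
        change e.pullback (c • f : lp (fun _ : X => ℂ) 2) x = c • e.pullback f x
        cases h : e x <;> simp [pullback, h] } 1 fun f => by
      rw [one_mul]
      exact lp.norm_le_of_forall_sum_le (by norm_num) (norm_nonneg _) (e.sum_norm_pullback_le f)

theorem toL2_apply (e : X ≃. X) (f : lp (fun _ : X => ℂ) 2) (x : X) :
    e.toL2 f x = (e x).elim 0 f := rfl

/-- Pullback reverses composition, but `trans` composes from left to right, so the order of the
factors is kept. -/
theorem toL2_mul (e e' : X ≃. X) : e.toL2 * e'.toL2 = (e.trans e').toL2 := by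
  ext f x
  change e.toL2 (e'.toL2 f) x = _
  simp only [toL2_apply]
  change _ = ((e x).bind e').elim 0 f
  cases e x <;> rfl

theorem toL2_single [DecidableEq X] (e : X ≃. X) (x : X) :
    e.toL2 (lp.single 2 x 1) = (e.symm x).elim 0 fun y => lp.single 2 y 1 := by
  refine lp.ext (funext fun y => ?_)
  rw [toL2_apply]
  cases h : e.symm x with
  | none =>
    cases h' : e y with
    | none => simp
    | some z =>
      have hz : z ≠ x := by
        rintro rfl
        rw [← PEquiv.eq_some_iff, h] at h'
        cases h'
      simp [lp.single_apply, hz]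
  | some w =>
    rw [PEquiv.eq_some_iff] at h
    by_cases hwy : y = w
    · subst hwy; simp [h]
    · cases h' : e y with
      | none => simp [lp.single_apply, hwy]
      | some z =>
        have hz : z ≠ x := by
          rintro rfl
          exact hwy (e.inj h' h)
        simp [lp.single_apply, hwy, hz]

/-- Compare coordinates: `⟨δ_x, e* f⟩ = ⟨e δ_x, f⟩`, and `e δ_x` is the basis vector at the preimage
of `x`, or `0`. -/
theorem star_toL2 (e : X ≃. X) : star e.toL2 = e.symm.toL2 := by
  classical
  rw [ContinuousLinearMap.star_eq_adjoint]
  ext f x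
  have h1 : ContinuousLinearMap.adjoint e.toL2 f x =
      inner ℂ (lp.single 2 x (1 : ℂ)) (ContinuousLinearMap.adjoint e.toL2 f) := by
    rw [lp.inner_single_left]; simp
  rw [h1, ContinuousLinearMap.adjoint_inner_right, toL2_single, toL2_apply]
  cases e.symm x with
  | none => simp
  | some y => simp [lp.inner_single_left]

end PEquiv

/-! ### The representation on infinite paths -/

namespace RowFiniteGraph

/-- The infinite paths of a graph. -/
@[ext]
structure InfPath (G : RowFiniteGraph.{u}) : Type u where
  /-- the arrows of the path -/
  arrow : ℕ → G.Ar
  range_arrow : ∀ n, G.r (arrow n) = G.s (arrow (n + 1))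

namespace InfPath

variable {G : RowFiniteGraph.{u}}

/-- The path obtained by deleting the first arrow. -/
def tail (y : G.InfPath) : G.InfPath := ⟨fun n => y.arrow (n + 1), fun n => y.range_arrow (n + 1)⟩

/-- The path obtained by adding a first arrow. -/
def cons (a : G.Ar) (x : G.InfPath) (h : G.r a = G.s (x.arrow 0)) : G.InfPath :=
  ⟨fun n => Nat.casesOn n a x.arrow, fun n => by cases n; exacts [h, x.range_arrow _]⟩

theorem exists_source_eq (v : G.V) : ∃ y : G.InfPath, G.s (y.arrow 0) = v := by
  choose a ha using G.no_sink
  exact ⟨⟨fun n => Nat.rec (a v) (fun _ b => a (G.r b)) n, fun n => (ha _).symm⟩, ha v⟩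

open Classical in
/-- The partial bijection that deletes the first arrow `a`. -/
noncomputable def shift (a : G.Ar) : G.InfPath ≃. G.InfPath where
  toFun y := if y.arrow 0 = a then some y.tail else none
  invFun x := if h : G.r a = G.s (x.arrow 0) then some (cons a x h) else none
  inv y x := by
    constructor
    · intro h
      split_ifs at h with hx
      obtain rfl : cons a x hx = y := by simpa using h
      exact if_pos rfl
    · intro h
      split_ifs at h with hy
      obtain rfl : y.tail = x := by simpa using h
      have hx : G.r a = G.s (y.tail.arrow 0) := by rw [← hy]; exact y.range_arrow 0
      rw [dif_pos hx]
      refine congrArg some (InfPath.ext (funext fun n => ?_))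
      cases n
      exacts [hy.symm, rfl]

theorem shift_of_eq {a : G.Ar} {y : G.InfPath} (h : y.arrow 0 = a) : shift a y = some y.tail := if_pos h

theorem shift_of_ne {a : G.Ar} {y : G.InfPath} (h : y.arrow 0 ≠ a) : shift a y = none := if_neg h

theorem isSome_shift {a : G.Ar} {y : G.InfPath} : (shift a y).isSome ↔ y.arrow 0 = a := by
  by_cases h : y.arrow 0 = a
  · simp [shift_of_eq, h]
  · simp [shift_of_ne, h]

theorem isSome_shift_symm {a : G.Ar} {x : G.InfPath} :
    ((shift a).symm x).isSome ↔ G.s (x.arrow 0) = G.r a := by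
  classical
  change (if h : G.r a = G.s (x.arrow 0) then some (cons a x h) else none).isSome ↔ _
  split_ifs with h
  · simp [h]
  · simpa [eq_comm] using h

end InfPath

open Classical in
theorem toL2_ofSet_apply {X : Type*} (s : Set X) (f : lp (fun _ : X => ℂ) 2) (x : X) :
    (PEquiv.ofSet s).toL2 f x = if x ∈ s then f x else 0 := by
  rw [PEquiv.toL2_apply]
  by_cases h : x ∈ s
  · rw [PEquiv.ofSet_eq_some_self_iff.2 h]; simp [h]
  · have : (PEquiv.ofSet s) x = none := if_neg h
    simp [this, h]

open Classical in
/-- The representation of a graph on `ℓ²` of its infinite paths. -/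
noncomputable def pathFamily (G : RowFiniteGraph.{u}) :
    G.Family (lp (fun _ : G.InfPath => ℂ) 2 →L[ℂ] lp (fun _ : G.InfPath => ℂ) 2) where
  S a := (InfPath.shift a).toL2
  P v := (PEquiv.ofSet {y : G.InfPath | G.s (y.arrow 0) = v}).toL2
  proj v := ⟨by
    rw [IsIdempotentElem, PEquiv.toL2_mul]
    congr 1
    ext y z
    simp only [PEquiv.trans_eq_some, PEquiv.ofSet_eq_some_iff]
    aesop, by
    rw [isSelfAdjoint_iff, PEquiv.star_toL2, PEquiv.ofSet_symm]⟩
  orth v w h := by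
    ext f y
    simp only [mul_apply_eq_comp, toL2_ofSet_apply, Set.mem_ofPred_eq]
    split_ifs with h1 h2
    · exact absurd (h1.symm.trans h2) h
    all_goals rfl
  star_mul_self a := by
    rw [PEquiv.star_toL2, PEquiv.toL2_mul, PEquiv.symm_trans_self]
    congr 2
    ext x
    exact InfPath.isSome_shift_symm
  sum_out v := by
    simp only [PEquiv.star_toL2, PEquiv.toL2_mul, PEquiv.self_trans_symm]
    ext f y
    have h : (∑ a ∈ G.out v, (PEquiv.ofSet {y | (InfPath.shift a y).isSome}).toL2) f y =
        ∑ a ∈ G.out v, (PEquiv.ofSet {y | (InfPath.shift a y).isSome}).toL2 f y := by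
      rw [sum_apply, lp.coeFn_sum, Finset.sum_apply]
    rw [h]
    simp only [toL2_ofSet_apply, Set.mem_ofPred_eq, InfPath.isSome_shift]
    rw [Finset.sum_ite_eq]
    simp

/-- The first arrows of an infinite path. -/
def InfPath.take {G : RowFiniteGraph.{u}} (y : G.InfPath) (n : ℕ) : List G.Ar :=
  (List.range n).map y.arrow

/-- The path obtained by deleting the first arrows. -/
def InfPath.drop {G : RowFiniteGraph.{u}} (y : G.InfPath) (n : ℕ) : G.InfPath :=
  ⟨fun k => y.arrow (n + k), fun k => y.range_arrow (n + k)⟩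

theorem InfPath.take_succ {G : RowFiniteGraph.{u}} (y : G.InfPath) (n : ℕ) :
    y.take (n + 1) = y.take n ++ [y.arrow n] := by
  simp [InfPath.take, List.range_succ]

open Classical in
theorem star_pathFamily_S_single {G : RowFiniteGraph.{u}} (a : G.Ar) (y : G.InfPath) :
    star (G.pathFamily.S a) (lp.single 2 y 1) =
      if y.arrow 0 = a then lp.single 2 y.tail 1 else 0 := by
  change star (InfPath.shift a).toL2 _ = _
  rw [PEquiv.star_toL2, PEquiv.toL2_single, PEquiv.symm_symm]
  split_ifs with h
  · rw [InfPath.shift_of_eq h]; rfl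
  · rw [InfPath.shift_of_ne h]; rfl

open Classical in
theorem pathFamily_P_single {G : RowFiniteGraph.{u}} (v : G.V) (y : G.InfPath)
    (h : G.s (y.arrow 0) = v) : G.pathFamily.P v (lp.single 2 y 1) = lp.single 2 y 1 := by
  change (PEquiv.ofSet _).toL2 _ = _
  have h' : y ∈ {y : G.InfPath | G.s (y.arrow 0) = v} := h
  rw [PEquiv.toL2_single, PEquiv.ofSet_symm, PEquiv.ofSet_eq_some_self_iff.2 h']
  rfl

-- Each `S_a*` deletes a first arrow `a` from a basis vector or kills it, so `S_μ*` deletes the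
-- initial segment `μ`. The assumption on the source of `y` takes care of the factor `P_v`.
open Classical in
theorem star_pathElem_single {G : RowFiniteGraph.{u}} (v : G.V) (μ : List G.Ar) (y : G.InfPath)
    (h : G.s (y.arrow 0) = v) : star (G.pathFamily.pathElem v μ) (lp.single 2 y 1) =
      if μ = y.take μ.length then lp.single 2 (y.drop μ.length) 1 else 0 := by
  induction μ using List.reverseRecOn with
  | nil =>
    rw [Family.pathElem_nil, Family.star_P, pathFamily_P_single v y h, if_pos (by rfl)]
    congr 1
    exact InfPath.ext (funext fun n => by simp [InfPath.drop])
  | append_singleton μ a ih =>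
    rw [Family.pathElem_append_singleton, star_mul, mul_apply_eq_comp, ih,
      List.length_append, List.length_singleton, InfPath.take_succ]
    split_ifs with h1 h2 h2
    · rw [star_pathFamily_S_single]
      have h3 := List.append_inj_right' h2 rfl
      rw [if_pos (by simpa [InfPath.drop] using h3.symm)]
      congr 1
      exact InfPath.ext (funext fun n => by
        simp only [InfPath.drop, InfPath.tail]
        congr 1
        omega)
    · rw [star_pathFamily_S_single, if_neg]
      intro h3
      refine h2 ?_
      rw [← h1, ← h3]; rfl
    · exact absurd (List.append_inj_left' h2 rfl) h1
    · exact map_zero _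

open Classical in
/-- The diagonal matrix coefficients of the path representation. -/
theorem inner_pathElem_mul_star {G : RowFiniteGraph.{u}} (v : G.V) (μ ν : List G.Ar)
    (y : G.InfPath) (h : G.s (y.arrow 0) = v) (hl : μ.length = ν.length) :
    inner ℂ (lp.single 2 y (1 : ℂ)) ((G.pathFamily.pathElem v μ *
      star (G.pathFamily.pathElem v ν)) (lp.single 2 y (1 : ℂ))) =
      if μ = ν ∧ μ = y.take μ.length then 1 else 0 := by
  rw [mul_apply_eq_comp, ← ContinuousLinearMap.adjoint_inner_left,
    ← ContinuousLinearMap.star_eq_adjoint, star_pathElem_single v _ y h,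
    star_pathElem_single v _ y h]
  by_cases h1 : μ = y.take μ.length
  · by_cases h2 : ν = y.take ν.length
    · have : μ = ν := by rw [h1, h2, hl]
      subst this
      rw [if_pos h1, if_pos ⟨rfl, h1⟩, lp.inner_single_left]
      simp
    · rw [if_neg h2, inner_zero_right, if_neg]
      rintro ⟨rfl, h3⟩
      exact h2 h3
  · rw [if_neg h1, inner_zero_left, if_neg fun h => h1 h.2]

end RowFiniteGraph

/-! ### Matrix units of the AF algebra -/

namespace BratteliDiagram

variable {Br : BratteliDiagram.{u}}

theorem isPath_nil (v : Br.V) : Br.IsPath v [] v := rfl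

theorem level_of_isPath {v w : Br.V} {μ : List Br.Ar} (h : Br.IsPath v μ w) :
    Br.level w = Br.level v + μ.length := by
  induction μ generalizing v with
  | nil =>
    obtain rfl : v = w := h
    simp
  | cons a μ ih =>
    obtain ⟨rfl, h⟩ := h
    rw [ih h, Br.level_range, List.length_cons]
    omega

theorem level_of_isPath_top {w : Br.V} {μ : List Br.Ar} (h : Br.IsPath Br.top μ w) :
    Br.level w = μ.length := by
  rw [level_of_isPath h, (Br.level_eq_zero _).2 rfl, zero_add]

theorem exists_isPath_top (w : Br.V) : ∃ μ, Br.IsPath Br.top μ w := by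
  induction h : Br.level w generalizing w with
  | zero => exact ⟨[], ((Br.level_eq_zero w).1 h).symm⟩
  | succ n ih =>
    obtain ⟨a, rfl⟩ := Br.only_source w fun hw => by
      rw [(Br.level_eq_zero w).2 hw] at h
      omega
    obtain ⟨μ, hμ⟩ := ih (Br.s a) (by have := Br.level_range a; omega)
    exact ⟨μ ++ [a], RowFiniteGraph.isPath_append_singleton.2 ⟨hμ, rfl⟩⟩

variable (Br) in
/-- The inclusion of `AF(Br)` in the graph C*-algebra. -/
noncomputable def incl : Br.AF →⋆ₙₐ[ℂ] Br.CStar where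
  toFun x := x.1
  map_smul' _ _ := rfl
  map_zero' := rfl
  map_add' _ _ := rfl
  map_mul' _ _ := rfl
  map_star' _ := rfl

theorem incl_injective : Function.Injective Br.incl := fun _ _ h => Subtype.ext h

theorem incl_one : Br.incl 1 = Br.gen.P Br.top := rfl

theorem incl_gaugeActionAF (F : Br.Ar → ℝ) (t : ℝ) (x : Br.AF) :
    Br.incl ((Br.gaugeActionAF F).hom t x) = Br.gaugeHom F t (Br.incl x) := rfl

/-- An element of the graph C*-algebra that lies in `AF(Br)`. -/
def ofMem (x : Br.CStar) (h : x ∈ Br.afSubalgebra) : Br.AF := (⟨x, h⟩ : ↥Br.afSubalgebra)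

theorem incl_ofMem (x : Br.CStar) (h : x ∈ Br.afSubalgebra) : Br.incl (ofMem x h) = x := rfl

open Classical in
variable (Br) in
/-- The element `S_μ S_ν*` of `AF(Br)`, for paths `μ` and `ν` from the top vertex with the same
range. -/
noncomputable def afUnit (μ ν : List Br.Ar) : Br.AF :=
  -- The default value `0` never occurs for two paths from the top vertex with the same range; see
  -- `incl_afUnit`.
  if h : Br.gen.pathElem Br.top μ * star (Br.gen.pathElem Br.top ν) ∈ Br.afSubalgebra then
    ofMem _ h else 0

variable {μ ν : List Br.Ar} {w : Br.V}

theorem incl_afUnit (hμ : Br.IsPath Br.top μ w) (hν : Br.IsPath Br.top ν w) :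
    Br.incl (Br.afUnit μ ν) = Br.gen.pathElem Br.top μ * star (Br.gen.pathElem Br.top ν) := by
  have h : Br.gen.pathElem Br.top μ * star (Br.gen.pathElem Br.top ν) ∈ Br.afSubalgebra :=
    Br.matrixUnits_subset μ.length ⟨μ, ν, w, hμ, hν, rfl, by
      rw [← level_of_isPath_top hμ, level_of_isPath_top hν], rfl⟩
  rw [afUnit, dif_pos h, incl_ofMem]

theorem afUnit_nil : Br.afUnit [] [] = 1 := by
  refine incl_injective ?_
  rw [incl_afUnit (isPath_nil _) (isPath_nil _), incl_one, RowFiniteGraph.Family.pathElem_nil,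
    RowFiniteGraph.Family.star_P, RowFiniteGraph.Family.P_mul_P]

theorem afUnit_mul_afUnit {ρ : List Br.Ar} (hμ : Br.IsPath Br.top μ w) (hν : Br.IsPath Br.top ν w)
    (hρ : Br.IsPath Br.top ρ w) : Br.afUnit μ ν * Br.afUnit ν ρ = Br.afUnit μ ρ := by
  refine incl_injective ?_
  rw [map_mul, incl_afUnit hμ hν, incl_afUnit hν hρ, incl_afUnit hμ hρ, mul_assoc,
    ← mul_assoc (star _), RowFiniteGraph.Family.star_pathElem_mul_pathElem_self _ hν, ← mul_assoc,
    RowFiniteGraph.Family.pathElem_mul_P _ hμ]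

theorem afUnit_mul_afUnit_of_ne {ν' ρ : List Br.Ar} {w' : Br.V} (hμ : Br.IsPath Br.top μ w)
    (hν : Br.IsPath Br.top ν w) (hν' : Br.IsPath Br.top ν' w') (hρ : Br.IsPath Br.top ρ w')
    (hl : ν.length = ν'.length) (hne : ν ≠ ν') : Br.afUnit μ ν * Br.afUnit ν' ρ = 0 := by
  refine incl_injective ?_
  rw [map_mul, incl_afUnit hμ hν, incl_afUnit hν' hρ, mul_assoc,
    ← mul_assoc (star _), RowFiniteGraph.Family.star_pathElem_mul_pathElem_of_ne _ hν hν' hl hne,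
    zero_mul, mul_zero, map_zero]

theorem star_afUnit (hμ : Br.IsPath Br.top μ w) (hν : Br.IsPath Br.top ν w) :
    star (Br.afUnit μ ν) = Br.afUnit ν μ := by
  refine incl_injective ?_
  rw [map_star, incl_afUnit hμ hν, incl_afUnit hν hμ, star_mul, star_star]

theorem isPath_append_out {a : Br.Ar} (hμ : Br.IsPath Br.top μ w) (ha : a ∈ Br.out w) :
    Br.IsPath Br.top (μ ++ [a]) (Br.r a) :=
  RowFiniteGraph.isPath_append_singleton.2 ⟨by rwa [RowFiniteGraph.mem_out.1 ha], rfl⟩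

theorem afUnit_eq_sum (hμ : Br.IsPath Br.top μ w) (hν : Br.IsPath Br.top ν w) :
    Br.afUnit μ ν = ∑ a ∈ Br.out w, Br.afUnit (μ ++ [a]) (ν ++ [a]) := by
  refine incl_injective ?_
  rw [map_sum, incl_afUnit hμ hν, RowFiniteGraph.Family.pathElem_mul_star_eq_sum _ hμ]
  exact Finset.sum_congr rfl fun a ha =>
    (incl_afUnit (isPath_append_out hμ ha) (isPath_append_out hν ha)).symm

variable (Br) in
/-- The linear span of the matrix units of level `n`. -/
noncomputable def unitSpan (n : ℕ) : Submodule ℂ Br.AF :=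
  Submodule.span ℂ {x | ∃ μ ν w, Br.IsPath Br.top μ w ∧ Br.IsPath Br.top ν w ∧ μ.length = n ∧
    ν.length = n ∧ x = Br.afUnit μ ν}

theorem afUnit_mem_unitSpan {n : ℕ} (hμ : Br.IsPath Br.top μ w) (hν : Br.IsPath Br.top ν w)
    (hn : Br.level w = n) : Br.afUnit μ ν ∈ Br.unitSpan n :=
  Submodule.subset_span ⟨μ, ν, w, hμ, hν, (level_of_isPath_top hμ).symm.trans hn,
    (level_of_isPath_top hν).symm.trans hn, rfl⟩

theorem unitSpan_mono : Monotone Br.unitSpan := by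
  refine monotone_nat_of_le_succ fun n => Submodule.span_le.2 ?_
  rintro _ ⟨μ, ν, w, hμ, hν, hμn, -, rfl⟩
  rw [SetLike.mem_coe, afUnit_eq_sum hμ hν]
  refine Submodule.sum_mem _ fun a ha => ?_
  refine afUnit_mem_unitSpan (isPath_append_out hμ ha) (isPath_append_out hν ha) ?_
  rw [Br.level_range, RowFiniteGraph.mem_out.1 ha, level_of_isPath_top hμ, hμn]

theorem mul_mem_unitSpan {n : ℕ} {x y : Br.AF} (hx : x ∈ Br.unitSpan n) (hy : y ∈ Br.unitSpan n) :
    x * y ∈ Br.unitSpan n := by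
  induction hx using Submodule.span_induction with
  | zero => rw [zero_mul]; exact Submodule.zero_mem _
  | add a b _ _ ha hb => rw [add_mul]; exact Submodule.add_mem _ ha hb
  | smul c a _ ha => rw [smul_mul_assoc]; exact Submodule.smul_mem _ c ha
  | mem a ha =>
    obtain ⟨μ, ν, w, hμ, hν, hμn, hνn, rfl⟩ := ha
    induction hy using Submodule.span_induction with
    | zero => rw [mul_zero]; exact Submodule.zero_mem _
    | add a b _ _ ha hb => rw [mul_add]; exact Submodule.add_mem _ ha hb
    | smul c a _ ha => rw [mul_smul_comm]; exact Submodule.smul_mem _ c ha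
    | mem b hb =>
      obtain ⟨ν', ρ, w', hν', hρ, hν'n, hρn, rfl⟩ := hb
      by_cases h : ν = ν'
      · subst h
        obtain rfl := hν.range_unique hν'
        rw [afUnit_mul_afUnit hμ hν hρ]
        exact afUnit_mem_unitSpan hμ hρ (by rw [level_of_isPath_top hμ, hμn])
      · rw [afUnit_mul_afUnit_of_ne hμ hν hν' hρ (hνn.trans hν'n.symm) h]
        exact Submodule.zero_mem _

theorem star_mem_unitSpan {n : ℕ} {x : Br.AF} (hx : x ∈ Br.unitSpan n) :
    star x ∈ Br.unitSpan n := by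
  induction hx using Submodule.span_induction with
  | zero => rw [star_zero]; exact Submodule.zero_mem _
  | add a b _ _ ha hb => rw [star_add]; exact Submodule.add_mem _ ha hb
  | smul c a _ ha => rw [star_smul]; exact Submodule.smul_mem _ _ ha
  | mem a ha =>
    obtain ⟨μ, ν, w, hμ, hν, hμn, hνn, rfl⟩ := ha
    rw [star_afUnit hμ hν]
    exact afUnit_mem_unitSpan hν hμ (by rw [level_of_isPath_top hμ, hμn])

/-- The spans of the levels are *-algebras and increase with the level, so their union is already a
*-algebra. -/
theorem exists_mem_unitSpan_of_mem_adjoin {x : Br.CStar}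
    (hx : x ∈ NonUnitalStarAlgebra.adjoin ℂ (⋃ n, Br.matrixUnits n)) :
    ∃ n, ∃ z ∈ Br.unitSpan n, Br.incl z = x := by
  induction hx using NonUnitalStarAlgebra.adjoin_induction with
  | mem x hx =>
    obtain ⟨n, μ, ν, w, hμ, hν, hμn, -, rfl⟩ := Set.mem_iUnion.1 hx
    exact ⟨n, Br.afUnit μ ν, afUnit_mem_unitSpan hμ hν (by rw [level_of_isPath_top hμ, hμn]),
      incl_afUnit hμ hν⟩
  | zero => exact ⟨0, 0, Submodule.zero_mem _, map_zero _⟩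
  | add x y _ _ hx hy =>
    obtain ⟨n, z, hz, rfl⟩ := hx
    obtain ⟨m, z', hz', rfl⟩ := hy
    exact ⟨max n m, z + z', Submodule.add_mem _ (unitSpan_mono (le_max_left n m) hz)
      (unitSpan_mono (le_max_right n m) hz'), map_add _ _ _⟩
  | mul x y _ _ hx hy =>
    obtain ⟨n, z, hz, rfl⟩ := hx
    obtain ⟨m, z', hz', rfl⟩ := hy
    exact ⟨max n m, z * z', mul_mem_unitSpan (unitSpan_mono (le_max_left n m) hz)
      (unitSpan_mono (le_max_right n m) hz'), map_mul _ _ _⟩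
  | smul c x _ hx =>
    obtain ⟨n, z, hz, rfl⟩ := hx
    exact ⟨n, c • z, Submodule.smul_mem _ c hz, map_smul _ _ _⟩
  | star x _ hx =>
    obtain ⟨n, z, hz, rfl⟩ := hx
    exact ⟨n, star z, star_mem_unitSpan hz, map_star _ _⟩

theorem dense_iUnion_unitSpan : Dense (⋃ n, (Br.unitSpan n : Set Br.AF)) := by
  intro x
  have h2 : x.1 ∈ closure
      (NonUnitalStarAlgebra.adjoin ℂ (⋃ n, Br.matrixUnits n) : Set Br.CStar) := x.2
  obtain ⟨y, hy, hyx⟩ := mem_closure_iff_seq_limit.1 h2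
  choose n z hz hzy using fun k => exists_mem_unitSpan_of_mem_adjoin (hy k)
  refine mem_closure_iff_seq_limit.2 ⟨z, fun k => Set.mem_iUnion.2 ⟨n k, hz k⟩, ?_⟩
  refine tendsto_subtype_rng.2 ?_
  convert! hyx using 2 with k
  exact hzy k

/-- A closed subspace that contains the matrix units is everything. -/
theorem mem_of_afUnit_mem (N : Submodule ℂ Br.AF) (hN : IsClosed (N : Set Br.AF))
    (h : ∀ μ ν w, Br.IsPath Br.top μ w → Br.IsPath Br.top ν w → Br.afUnit μ ν ∈ N) (x : Br.AF) :
    x ∈ N := by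
  have h1 : (⋃ n, (Br.unitSpan n : Set Br.AF)) ⊆ N := Set.iUnion_subset fun n =>
    Submodule.span_le.2 fun _ ⟨μ, ν, w, hμ, hν, _, _, he⟩ => he ▸ h μ ν w hμ hν
  exact closure_minimal h1 hN (dense_iUnion_unitSpan x)

/-- Continuous linear maps on `AF(Br)` that agree on the matrix units agree. -/
theorem eq_of_eq_afUnit {f g : Br.AF →L[ℂ] ℂ}
    (h : ∀ μ ν w, Br.IsPath Br.top μ w → Br.IsPath Br.top ν w →
      f (Br.afUnit μ ν) = g (Br.afUnit μ ν)) (x : Br.AF) : f x = g x :=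
  mem_of_afUnit_mem (LinearMap.eqLocus f.toLinearMap g.toLinearMap)
    (isClosed_eq f.continuous g.continuous) h x

/-- The weight `F(a₁) + ⋯ + F(aₙ)` of a path. -/
def pathWeight (F : Br.Ar → ℝ) (μ : List Br.Ar) : ℝ := (μ.map F).sum

theorem pathWeight_append_singleton (F : Br.Ar → ℝ) (μ : List Br.Ar) (a : Br.Ar) :
    pathWeight F (μ ++ [a]) = pathWeight F μ + F a := by
  simp [pathWeight]

theorem gaugeHom_pathElem_eq (F : Br.Ar → ℝ) (t : ℝ) (v : Br.V) (μ : List Br.Ar) :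
    Br.gaugeHom F t (Br.gen.pathElem v μ) =
      Complex.exp (Complex.I * t * pathWeight F μ) • Br.gen.pathElem v μ := by
  induction μ using List.reverseRecOn with
  | nil => simp [pathWeight, RowFiniteGraph.gaugeHom_P]
  | append_singleton μ a ih =>
    rw [RowFiniteGraph.Family.pathElem_append_singleton, map_mul, ih, RowFiniteGraph.gaugeHom_S,
      smul_mul_smul_comm, ← Complex.exp_add, pathWeight_append_singleton]
    push_cast
    ring_nf

theorem gaugeActionAF_afUnit (F : Br.Ar → ℝ) (t : ℝ) (hμ : Br.IsPath Br.top μ w)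
    (hν : Br.IsPath Br.top ν w) :
    (Br.gaugeActionAF F).hom t (Br.afUnit μ ν) =
      Complex.exp (Complex.I * t * (pathWeight F μ - pathWeight F ν : ℝ)) • Br.afUnit μ ν := by
  refine incl_injective ?_
  rw [incl_gaugeActionAF, map_smul, incl_afUnit hμ hν, map_mul, map_star, gaugeHom_pathElem_eq,
    gaugeHom_pathElem_eq, star_smul, smul_mul_smul_comm, Complex.star_def, ← Complex.exp_conj,
    ← Complex.exp_add]
  congr 2
  simp
  ring

/-- Matrix units are eigenvectors of the action, so the eigenvalue can simply be continued to
complex time. -/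
theorem isEntireExtension_afUnit (F : Br.Ar → ℝ) (hμ : Br.IsPath Br.top μ w)
    (hν : Br.IsPath Br.top ν w) :
    (Br.gaugeActionAF F).IsEntireExtension (Br.afUnit μ ν) fun z =>
      Complex.exp (Complex.I * z * (pathWeight F μ - pathWeight F ν : ℝ)) • Br.afUnit μ ν :=
  ⟨by fun_prop, fun t => (gaugeActionAF_afUnit F t hμ hν).symm⟩

end BratteliDiagram

/-! ### KMS functionals and vertex weights -/

/-- Entire functions that agree on the real line agree. -/
theorem eq_of_differentiable_of_eq_ofReal {f g : ℂ → ℂ} (hf : Differentiable ℂ f)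
    (hg : Differentiable ℂ g) (h : ∀ t : ℝ, f t = g t) : f = g := by
  refine AnalyticOnNhd.eq_of_frequently_eq (z₀ := 0) (fun z _ => hf.analyticAt z)
    (fun z _ => hg.analyticAt z) ?_
  -- Non-zero real numbers accumulate at `0`, which is all that the identity theorem needs.
  have h1 : Filter.Tendsto (fun t : ℝ => (t : ℂ)) (nhdsWithin 0 {0}ᶜ) (nhdsWithin 0 {0}ᶜ) := by
    refine tendsto_nhdsWithin_iff.2 ⟨?_, ?_⟩
    · exact (Complex.continuous_ofReal.tendsto' 0 0 rfl).mono_left nhdsWithin_le_nhds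
    · filter_upwards [self_mem_nhdsWithin] with t ht
      simpa using ht
  exact h1.frequently (Filter.Frequently.of_forall h)

namespace BratteliDiagram

variable {Br : BratteliDiagram.{u}} {F : Br.Ar → ℝ} {β : ℝ} {μ ν : List Br.Ar} {w : Br.V}

/-- A functional on `AF(Br)` that vanishes on the off-diagonal matrix units and takes the value
`e^{-β F(μ)} φ(r(μ))` at `S_μ S_μ*`. -/
def HasVertexWeights (F : Br.Ar → ℝ) (β : ℝ) (ω : WeakDual ℂ Br.AF) (φ : Br.V → ℝ) : Prop :=
  (∀ μ ν w, Br.IsPath Br.top μ w → Br.IsPath Br.top ν w → μ ≠ ν → ω (Br.afUnit μ ν) = 0) ∧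
  ∀ μ w, Br.IsPath Br.top μ w →
    ω (Br.afUnit μ μ) = ((Real.exp (-β * pathWeight F μ) * φ w : ℝ) : ℂ)

/-- A function on the vertices with `φ(v) = ∑ e^{-β F(a)} φ(r(a))`, the sum over the arrows `a`
emitted from `v`. -/
def IsHarmonic (F : Br.Ar → ℝ) (β : ℝ) (φ : Br.V → ℝ) : Prop :=
  ∀ v, φ v = ∑ a ∈ Br.out v, Real.exp (-β * F a) * φ (Br.r a)

/-- Evaluate `ω` at `E_{μμ} = ∑_a E_{μa,μa}` for some path `μ` to `v`, and cancel `e^{-βF(μ)}`. -/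
theorem HasVertexWeights.isHarmonic {ω : WeakDual ℂ Br.AF} {φ : Br.V → ℝ}
    (h : HasVertexWeights F β ω φ) : IsHarmonic F β φ := by
  intro v
  obtain ⟨μ, hμ⟩ := exists_isPath_top v
  have h1 := h.2 μ v hμ
  rw [afUnit_eq_sum hμ hμ, map_sum,
    Finset.sum_congr rfl fun a ha => h.2 _ _ (isPath_append_out hμ ha)] at h1
  norm_cast at h1
  simp_rw [pathWeight_append_singleton, mul_add, Real.exp_add, mul_assoc] at h1
  rw [← Finset.mul_sum] at h1
  exact (mul_left_cancel₀ (Real.exp_pos _).ne' h1).symm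

theorem HasVertexWeights.eq {ω ω' : WeakDual ℂ Br.AF} {φ : Br.V → ℝ}
    (h : HasVertexWeights F β ω φ) (h' : HasVertexWeights F β ω' φ) : ω = ω' := by
  refine DFunLike.ext _ _ (eq_of_eq_afUnit (f := WeakDual.toStrongDual ω)
    (g := WeakDual.toStrongDual ω') fun μ ν w hμ hν => ?_)
  change ω _ = ω' _
  by_cases hμν : μ = ν
  · subst hμν
    rw [h.2 μ w hμ, h'.2 μ w hμ]
  · rw [h.1 μ ν w hμ hν hμν, h'.1 μ ν w hμ hν hμν]

variable (Br) in
/-- A path from the top vertex to a given vertex. -/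
noncomputable def pathTo (w : Br.V) : List Br.Ar := (exists_isPath_top w).choose

theorem isPath_pathTo (w : Br.V) : Br.IsPath Br.top (Br.pathTo w) w :=
  (exists_isPath_top w).choose_spec

/-- The vertex weights of a KMS functional. -/
noncomputable def vertexWeight (F : Br.Ar → ℝ) (β : ℝ) (ω : WeakDual ℂ Br.AF) (w : Br.V) : ℝ :=
  Real.exp (β * pathWeight F (Br.pathTo w)) * (ω (Br.afUnit (Br.pathTo w) (Br.pathTo w))).re

/-- The path chosen in `vertexWeight` thus plays no role once weights exist. -/
theorem HasVertexWeights.vertexWeight_eq {ω : WeakDual ℂ Br.AF} {φ : Br.V → ℝ}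
    (h : HasVertexWeights F β ω φ) (w : Br.V) : vertexWeight F β ω w = φ w := by
  rw [vertexWeight, h.2 _ _ (isPath_pathTo w), Complex.ofReal_re, ← mul_assoc, ← Real.exp_add]
  simp

/-- The value of a functional at the diagonal matrix units is real and non-negative. -/
theorem exists_nonneg_apply_afUnit {ω : WeakDual ℂ Br.AF} (hω : OneParameterGroup.IsPositive ω)
    (hμ : Br.IsPath Br.top μ w) : ∃ c : ℝ, 0 ≤ c ∧ ω (Br.afUnit μ μ) = c := by
  obtain ⟨c, hc, h⟩ := hω (Br.afUnit μ μ)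
  rw [star_afUnit hμ hμ, afUnit_mul_afUnit hμ hμ hμ] at h
  exact ⟨c, hc, h⟩

theorem vertexWeight_nonneg {ω : WeakDual ℂ Br.AF} (hω : OneParameterGroup.IsPositive ω)
    (w : Br.V) : 0 ≤ vertexWeight F β ω w := by
  obtain ⟨c, hc, h⟩ := exists_nonneg_apply_afUnit hω (isPath_pathTo w)
  rw [vertexWeight, h]
  exact mul_nonneg (Real.exp_pos _).le hc

theorem kms_afUnit {ω : WeakDual ℂ Br.AF} (hω : (Br.gaugeActionAF F).KMSCondition β ω)
    (hμ : Br.IsPath Br.top μ w) (hν : Br.IsPath Br.top ν w) {ρ σ : List Br.Ar} {w' : Br.V}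
    (hρ : Br.IsPath Br.top ρ w') (hσ : Br.IsPath Br.top σ w') :
    ω (Br.afUnit μ ν * Br.afUnit ρ σ) =
      (Real.exp (-β * (pathWeight F μ - pathWeight F ν)) : ℝ) *
        ω (Br.afUnit ρ σ * Br.afUnit μ ν) := by
  rw [hω _ _ _ (isEntireExtension_afUnit F hμ hν) ⟨_, isEntireExtension_afUnit F hρ hσ⟩,
    mul_smul_comm, map_smul, smul_eq_mul]
  congr 1
  rw [Complex.ofReal_exp]
  congr 1
  push_cast
  rw [← mul_assoc, Complex.I_mul_I]
  ring

/-- For `μ ≠ ν`, commuting the factors of `E_{μν} = E_{μμ} E_{μν}` costs the factor `1` and produces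
`E_{μν} E_{μμ} = 0`. On the diagonal, commuting the factors of `E_{μμ} = E_{μρ} E_{ρμ}`, with `ρ`
the chosen path to `w`, gives `e^{-β(F(μ)-F(ρ))} ω(E_{ρρ})`. -/
theorem hasVertexWeights_of_kms {ω : WeakDual ℂ Br.AF}
    (hω : ω ∈ (Br.gaugeActionAF F).positiveKMS β) :
    HasVertexWeights F β ω (vertexWeight F β ω) := by
  obtain ⟨hpos, hkms⟩ := hω
  refine ⟨fun μ ν w hμ hν hne => ?_, fun μ w hμ => ?_⟩
  · have h := kms_afUnit hkms hμ hμ hμ hν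
    rwa [afUnit_mul_afUnit hμ hμ hν, afUnit_mul_afUnit_of_ne hμ hν hμ hμ
      (by rw [← level_of_isPath_top hν, level_of_isPath_top hμ]) hne.symm, map_zero,
      mul_zero] at h
  · have hw := isPath_pathTo w
    have h := kms_afUnit hkms hμ hw hw hμ
    rw [afUnit_mul_afUnit hμ hw hμ, afUnit_mul_afUnit hw hμ hw] at h
    obtain ⟨c, -, hc⟩ := exists_nonneg_apply_afUnit hpos hw
    rw [h, vertexWeight, hc, Complex.ofReal_re, ← mul_assoc, ← Real.exp_add, ← Complex.ofReal_mul]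
    ring_nf

namespace HasVertexWeights

variable {ω : WeakDual ℂ Br.AF} {φ : Br.V → ℝ}

theorem apply_afUnit_mul_afUnit (h : HasVertexWeights F β ω φ)
    (hμ : Br.IsPath Br.top μ w) (hν : Br.IsPath Br.top ν w)
    {ρ σ : List Br.Ar} {w' : Br.V} (hρ : Br.IsPath Br.top ρ w') (hσ : Br.IsPath Br.top σ w')
    (hl : μ.length = ρ.length) :
    ω (Br.afUnit μ ν * Br.afUnit ρ σ) =
      (Real.exp (-β * (pathWeight F μ - pathWeight F ν)) : ℝ) *
        ω (Br.afUnit ρ σ * Br.afUnit μ ν) := by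
  have hνρ : ν.length = ρ.length := by rw [← hl, ← level_of_isPath_top hν, level_of_isPath_top hμ]
  have hσμ : σ.length = μ.length := by rw [hl, ← level_of_isPath_top hσ, level_of_isPath_top hρ]
  by_cases h1 : ν = ρ <;> by_cases h2 : σ = μ
  · subst h1 h2
    rw [afUnit_mul_afUnit hμ hν hμ, afUnit_mul_afUnit hν hμ hν, h.2 _ _ hμ, h.2 _ _ hν,
      ← Complex.ofReal_mul, ← mul_assoc, ← Real.exp_add]
    ring_nf
  · subst h1
    obtain rfl := hν.range_unique hρ
    rw [afUnit_mul_afUnit hμ hν hσ, h.1 _ _ _ hμ hσ (Ne.symm h2),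
      afUnit_mul_afUnit_of_ne hν hσ hμ hν hσμ h2, map_zero, mul_zero]
  · subst h2
    obtain rfl := hμ.range_unique hσ
    rw [afUnit_mul_afUnit hρ hμ hν, h.1 _ _ _ hρ hν (Ne.symm h1),
      afUnit_mul_afUnit_of_ne hμ hν hρ hμ hνρ h1, map_zero, mul_zero]
  · rw [afUnit_mul_afUnit_of_ne hμ hν hρ hσ hνρ h1, afUnit_mul_afUnit_of_ne hρ hσ hμ hν hσμ h2,
      map_zero, mul_zero]

/-- Here `k` is the number of levels by which `E_{μν}` has to be refined to be comparable with `x`;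
at `k = 0` all paths have the same length and the matrix unit relations decide. -/
theorem apply_afUnit_mul_of_mem (h : HasVertexWeights F β ω φ) {n k : ℕ}
    (hμ : Br.IsPath Br.top μ w)
    (hν : Br.IsPath Br.top ν w) (hn : μ.length + k = n) {x : Br.AF} (hx : x ∈ Br.unitSpan n) :
    ω (Br.afUnit μ ν * x) =
      (Real.exp (-β * (pathWeight F μ - pathWeight F ν)) : ℝ) * ω (x * Br.afUnit μ ν) := by
  induction k generalizing μ ν w with
  | zero =>
    induction hx using Submodule.span_induction with
    | zero => simp
    | add a b _ _ ha hb => rw [mul_add, add_mul, map_add, map_add, ha, hb, mul_add]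
    | smul c a _ ha =>
      rw [mul_smul_comm, smul_mul_assoc, map_smul, map_smul, ha, smul_eq_mul, smul_eq_mul]
      ring
    | mem a ha =>
      obtain ⟨ρ, σ, w', hρ, hσ, hρn, -, rfl⟩ := ha
      exact h.apply_afUnit_mul_afUnit hμ hν hρ hσ (by omega)
  | succ k ih =>
    rw [afUnit_eq_sum hμ hν, Finset.sum_mul, Finset.mul_sum, map_sum, map_sum, Finset.mul_sum]
    refine Finset.sum_congr rfl fun a ha => ?_
    -- Both paths grow by the same arrow, so `F(μ) - F(ν)` and hence the factor do not change.
    rw [ih (isPath_append_out hμ ha) (isPath_append_out hν ha) (by simp; omega),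
      pathWeight_append_singleton, pathWeight_append_singleton, add_sub_add_right_eq_sub]

theorem apply_afUnit_mul (h : HasVertexWeights F β ω φ)
    (hμ : Br.IsPath Br.top μ w) (hν : Br.IsPath Br.top ν w) (x : Br.AF) :
    ω (Br.afUnit μ ν * x) =
      (Real.exp (-β * (pathWeight F μ - pathWeight F ν)) : ℝ) * ω (x * Br.afUnit μ ν) := by
  have hω : Continuous ω := map_continuous ω
  refine closure_minimal (s := ⋃ n, (Br.unitSpan n : Set Br.AF)) (t := {x | ω (Br.afUnit μ ν * x) =
      (Real.exp (-β * (pathWeight F μ - pathWeight F ν)) : ℝ) * ω (x * Br.afUnit μ ν)})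
      ?_ ?_ (dense_iUnion_unitSpan x)
  · refine Set.iUnion_subset fun n x hx => ?_
    exact h.apply_afUnit_mul_of_mem hμ hν rfl (unitSpan_mono (Nat.le_add_left n μ.length) hx)
  · exact isClosed_eq (by fun_prop) (by fun_prop)

/-- The action fixes the diagonal matrix units, and `ω` does not see the others. -/
theorem apply_gaugeActionAF (h : HasVertexWeights F β ω φ) (t : ℝ) (x : Br.AF) : ω ((Br.gaugeActionAF F).hom t x) = ω x := by
  let T : Br.AF →L[ℂ] Br.AF :=
    LinearMap.mkContinuous ((Br.gaugeActionAF F).hom t : Br.AF →ₗ[ℂ] Br.AF) 1 fun x => by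
      rw [one_mul]
      exact Br.norm_gaugeHom_le F t (Br.incl x)
  refine eq_of_eq_afUnit (f := (WeakDual.toStrongDual ω).comp T) (g := WeakDual.toStrongDual ω)
    (fun μ ν w hμ hν => ?_) x
  change ω ((Br.gaugeActionAF F).hom t (Br.afUnit μ ν)) = ω (Br.afUnit μ ν)
  rw [gaugeActionAF_afUnit F t hμ hν, map_smul]
  by_cases hne : μ = ν
  · subst hne
    simp
  · rw [h.1 _ _ _ hμ hν hne, smul_zero]

/-- By density `b` may be taken to be a matrix unit `E_{μν}`; put `c = F(μ) - F(ν)`. By invariance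
the entire functions `ω(E_{μν} f(z))` and `e^{-izc} ω(E_{μν} a)` agree for real `z`, hence at `z =
iβ`. The resulting factor `e^{βc}` cancels the `e^{-βc}` from commuting `E_{μν}` past `a`. -/
theorem kmsCondition (h : HasVertexWeights F β ω φ) : (Br.gaugeActionAF F).KMSCondition β ω := by
  intro a b f hf _
  let W : Br.AF →L[ℂ] ℂ := WeakDual.toStrongDual ω
  refine eq_of_eq_afUnit (f := W.comp (ContinuousLinearMap.mul ℂ Br.AF a))
    (g := W.comp ((ContinuousLinearMap.mul ℂ Br.AF).flip (f (Complex.I * β)))) ?_ b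
  intro μ ν w hμ hν
  change ω (a * Br.afUnit μ ν) = ω (Br.afUnit μ ν * f (Complex.I * β))
  set c := pathWeight F μ - pathWeight F ν with hc
  have h1 : (fun z => ω (Br.afUnit μ ν * f z)) =
      fun z => Complex.exp (-(Complex.I * z * c)) * ω (Br.afUnit μ ν * a) := by
    refine eq_of_differentiable_of_eq_ofReal ?_ (by fun_prop) fun t => ?_
    · exact (W.comp (ContinuousLinearMap.mul ℂ Br.AF (Br.afUnit μ ν))).differentiable.comp hf.1
    · rw [hf.2 t, ← h.apply_gaugeActionAF t (Br.afUnit μ ν * a), map_mul ((Br.gaugeActionAF F).hom t),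
        gaugeActionAF_afUnit F t hμ hν, smul_mul_assoc, map_smul, smul_eq_mul, ← mul_assoc,
        ← Complex.exp_add, ← hc]
      simp
  have h2 := congrFun h1 (Complex.I * β)
  rw [h2, h.apply_afUnit_mul hμ hν, ← hc, Complex.ofReal_exp, ← mul_assoc, ← Complex.exp_add,
    ← mul_assoc, Complex.I_mul_I]
  simp

end HasVertexWeights

end BratteliDiagram

/-! ### From harmonic functions to positive functionals -/

namespace RowFiniteGraph

theorem InfPath.take_of_le {G : RowFiniteGraph.{u}} (y : G.InfPath) {k n : ℕ} (h : k ≤ n) :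
    y.take k = (y.take n).take k := by
  rw [InfPath.take, InfPath.take, ← List.map_take, List.take_range, min_eq_left h]

theorem InfPath.exists_take_eq {G : RowFiniteGraph.{u}} {v w : G.V} {μ : List G.Ar}
    (h : G.IsPath v μ w) : ∃ y : G.InfPath, G.s (y.arrow 0) = v ∧ y.take μ.length = μ := by
  induction μ generalizing v with
  | nil =>
    obtain ⟨y, hy⟩ := InfPath.exists_source_eq v
    exact ⟨y, hy, rfl⟩
  | cons a μ ih =>
    obtain ⟨y, hy, hμ⟩ := ih h.2
    refine ⟨InfPath.cons a y hy.symm, h.1, ?_⟩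
    rw [InfPath.take, List.length_cons, List.range_succ_eq_map, List.map_cons, List.map_map]
    refine congrArg (a :: ·) ?_
    conv_rhs => rw [← hμ]
    rfl

end RowFiniteGraph

namespace BratteliDiagram

open RowFiniteGraph

variable {Br : BratteliDiagram.{u}}

variable (Br) in
/-- The range of a path from the top vertex. -/
def endpoint (μ : List Br.Ar) : Br.V := μ.foldl (fun _ a => Br.r a) Br.top

theorem endpoint_eq {μ : List Br.Ar} {w : Br.V} (h : Br.IsPath Br.top μ w) :
    Br.endpoint μ = w := by
  rcases List.eq_nil_or_concat' μ with rfl | ⟨μ, a, rfl⟩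
  · exact h
  · rw [endpoint, List.foldl_append]
    exact (isPath_append_singleton.1 h).2

section PathSum

variable {M N : Type*} [AddCommMonoid M] [AddCommMonoid N]

variable (Br) in
/-- The sum of `g(μ)` over the paths `μ` of length `n` from the top vertex. -/
noncomputable def pathSum : ℕ → (List Br.Ar → M) → M
  | 0, g => g []
  | n + 1, g => pathSum n fun μ => ∑ a ∈ Br.out (Br.endpoint μ), g (μ ++ [a])

/-- One induction for everything proved about sums over paths: any relation compatible with `0` and
`+` passes from the terms to the sums. It serves for equalities, norm bounds, positivity and
evaluation. -/
theorem pathSum_rel {P : M → N → Prop} (h0 : P 0 0)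
    (hadd : ∀ x x' y y', P x y → P x' y' → P (x + x') (y + y')) (n : ℕ) {g : List Br.Ar → M}
    {g' : List Br.Ar → N}
    (h : ∀ μ, Br.IsPath Br.top μ (Br.endpoint μ) → μ.length = n → P (g μ) (g' μ)) :
    P (Br.pathSum n g) (Br.pathSum n g') := by
  induction n generalizing g g' with
  | zero => exact h [] (isPath_nil _) rfl
  | succ n ih =>
    refine ih fun μ hμ hn => ?_
    have h1 : ∀ a ∈ Br.out (Br.endpoint μ), P (g (μ ++ [a])) (g' (μ ++ [a])) := fun a ha => by
      have h2 := isPath_append_out hμ ha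
      exact h _ (by rwa [endpoint_eq h2]) (by simp [hn])
    -- The pairs are summed in `M × N`, so that the relation becomes a predicate.
    have h3 := Finset.sum_induction (fun a => (g (μ ++ [a]), g' (μ ++ [a]))) (fun q => P q.1 q.2)
      (fun _ _ => hadd _ _ _ _) h0 h1
    rwa [Prod.fst_sum, Prod.snd_sum] at h3

theorem pathSum_congr {n : ℕ} {g g' : List Br.Ar → M}
    (h : ∀ μ, Br.IsPath Br.top μ (Br.endpoint μ) → μ.length = n → g μ = g' μ) :
    Br.pathSum n g = Br.pathSum n g' :=
  pathSum_rel rfl (fun _ _ _ _ h h' => by rw [h, h']) n h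

open Classical in
theorem pathSum_ite_eq {ν : List Br.Ar} {w : Br.V} (h : Br.IsPath Br.top ν w) (c : M) :
    Br.pathSum ν.length (fun μ => if μ = ν then c else 0) = c := by
  induction ν using List.reverseRecOn generalizing w with
  | nil => simp [pathSum]
  | append_singleton ν a ih =>
    obtain ⟨hν, rfl⟩ := isPath_append_singleton.1 h
    rw [List.length_append, List.length_singleton, pathSum]
    refine (pathSum_congr fun μ hμ _ => ?_).trans (ih hν)
    by_cases hμν : μ = ν
    · subst hμν
      simp [endpoint_eq hν]
    · rw [if_neg hμν]
      exact Finset.sum_eq_zero fun b _ => if_neg (by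
        intro hb
        exact hμν (List.append_inj' hb rfl).1)

end PathSum

/-- The weight `e^{-β F(μ)} φ(r(μ))` of a path from the top vertex. -/
noncomputable def gibbsWeight (F : Br.Ar → ℝ) (β : ℝ) (φ : Br.V → ℝ) (μ : List Br.Ar) : ℝ :=
  Real.exp (-β * pathWeight F μ) * φ (Br.endpoint μ)

variable {F : Br.Ar → ℝ} {β : ℝ} {φ : Br.V → ℝ}

/-- Harmonicity is exactly the additivity of the weights of cylinder sets. -/
theorem IsHarmonic.sum_gibbsWeight (hφ : IsHarmonic F β φ) {μ : List Br.Ar} {w : Br.V}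
    (hμ : Br.IsPath Br.top μ w) :
    ∑ a ∈ Br.out w, gibbsWeight F β φ (μ ++ [a]) = gibbsWeight F β φ μ := by
  rw [gibbsWeight, endpoint_eq hμ, hφ w, Finset.mul_sum]
  refine Finset.sum_congr rfl fun a ha => ?_
  rw [gibbsWeight, endpoint_eq (isPath_append_out hμ ha), pathWeight_append_singleton, mul_add,
    Real.exp_add, mul_assoc]

-- By additivity, the mass of the cylinder of `ν` can be computed from any level `n` at or below the
-- end of `ν`. The empty path gives the total mass `φ(v₀)`.
open Classical in
theorem IsHarmonic.pathSum_gibbsWeight (hφ : IsHarmonic F β φ) {ν : List Br.Ar} {w : Br.V}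
    (hν : Br.IsPath Br.top ν w) {n : ℕ} (hn : ν.length ≤ n) :
    Br.pathSum n (fun μ => if ν <+: μ then gibbsWeight F β φ μ else 0) = gibbsWeight F β φ ν := by
  induction n, hn using Nat.le_induction with
  | base =>
    refine (pathSum_congr fun μ _ hμ => ?_).trans (pathSum_ite_eq hν (gibbsWeight F β φ ν))
    by_cases h : μ = ν
    · subst h
      simp
    · rw [if_neg h, if_neg]
      exact fun h' => h (h'.eq_of_length hμ.symm).symm
  | succ n hn ih =>
    rw [pathSum, ← ih]
    refine pathSum_congr fun μ hμ hl => ?_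
    rw [← hφ.sum_gibbsWeight hμ]
    -- As `ν` is no longer than `μ`, it cannot reach the added arrow.
    have h1 : ∀ a, ν <+: μ ++ [a] ↔ ν <+: μ := by
      intro a
      rw [List.prefix_concat_iff]
      refine or_iff_right fun h => ?_
      rw [h, List.length_append, List.length_singleton] at hn
      omega
    simp only [h1]
    split_ifs
    · rfl
    · exact Finset.sum_const_zero

open Classical in
/-- The vector state of the path representation at an infinite path. -/
noncomputable def pathState (y : Br.InfPath) : Br.AF →L[ℂ] ℂ :=
  LinearMap.mkContinuous
    { toFun := fun x => inner ℂ (lp.single 2 y (1 : ℂ))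
        (Br.eval ⟨_, Br.pathFamily⟩ (Br.incl x) (lp.single 2 y (1 : ℂ)))
      map_add' := fun x x' => by rw [map_add, map_add, add_apply, inner_add_right]
      map_smul' := fun c x => by
        rw [map_smul, map_smul, smul_apply, inner_smul_right]; rfl } 1 fun x => by
    have h1 : ‖lp.single (E := fun _ : Br.InfPath => ℂ) 2 y (1 : ℂ)‖ = 1 := by
      rw [lp.norm_single (by norm_num), norm_one]
    have h2 : ‖Br.eval ⟨_, Br.pathFamily⟩ (Br.incl x)‖ ≤ ‖x‖ :=
      lp.norm_apply_le_norm ENNReal.top_ne_zero (Br.incl x).1 (⟨_, Br.pathFamily⟩ : Br.Rep)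
    refine (norm_inner_le_norm (𝕜 := ℂ) (E := lp (fun _ : Br.InfPath => ℂ) 2) _ _).trans ?_
    rw [h1, one_mul, one_mul]
    refine (ContinuousLinearMap.le_opNorm _ _).trans ?_
    rwa [h1, mul_one]

theorem norm_pathState_le (y : Br.InfPath) : ‖Br.pathState y‖ ≤ 1 :=
  LinearMap.mkContinuous_norm_le _ zero_le_one _

open Classical in
theorem pathState_apply (y : Br.InfPath) (x : Br.AF) :
    pathState y x = inner ℂ (lp.single 2 y (1 : ℂ))
        (Br.eval ⟨_, Br.pathFamily⟩ (Br.incl x) (lp.single 2 y (1 : ℂ))) := rfl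

theorem pathState_star_mul_self (y : Br.InfPath) (x : Br.AF) :
    ∃ c : ℝ, 0 ≤ c ∧ pathState y (star x * x) = c := by
  classical
  refine ⟨‖Br.eval ⟨_, Br.pathFamily⟩ (Br.incl x) (lp.single 2 y (1 : ℂ))‖ ^ 2, by positivity, ?_⟩
  rw [pathState_apply, map_mul, map_mul, map_star, map_star, mul_apply_eq_comp,
    ContinuousLinearMap.star_eq_adjoint, ContinuousLinearMap.adjoint_inner_right,
    inner_self_eq_norm_sq_to_K]
  simp

theorem eval_pathElem {π : Br.Rep} (v : Br.V) (μ : List Br.Ar) :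
    Br.eval π (Br.gen.pathElem v μ) = π.fam.pathElem v μ := by
  induction μ using List.reverseRecOn with
  | nil => rfl
  | append_singleton μ a ih =>
    rw [Family.pathElem_append_singleton, Family.pathElem_append_singleton, map_mul, ih,
      eval_gen_S]

open Classical in
theorem pathState_afUnit {y : Br.InfPath} (hy : Br.s (y.arrow 0) = Br.top) {μ ν : List Br.Ar}
    {w : Br.V} (hμ : Br.IsPath Br.top μ w) (hν : Br.IsPath Br.top ν w) :
    pathState y (Br.afUnit μ ν) = if μ = ν ∧ μ = y.take μ.length then 1 else 0 := by
  rw [pathState_apply, incl_afUnit hμ hν, map_mul, map_star, eval_pathElem, eval_pathElem]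
  exact inner_pathElem_mul_star Br.top μ ν y hy
    (by rw [← level_of_isPath_top hμ, level_of_isPath_top hν])

open Classical in
variable (Br) in
/-- An infinite path that extends a given path. -/
noncomputable def extendPath (μ : List Br.Ar) : Br.InfPath :=
  if h : ∃ y : Br.InfPath, Br.s (y.arrow 0) = Br.top ∧ y.take μ.length = μ then h.choose
  else (InfPath.exists_source_eq Br.top).choose

theorem extendPath_spec {μ : List Br.Ar} {w : Br.V} (hμ : Br.IsPath Br.top μ w) :
    Br.s ((Br.extendPath μ).arrow 0) = Br.top ∧ (Br.extendPath μ).take μ.length = μ := by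
  have h := InfPath.exists_take_eq hμ
  rw [extendPath, dif_pos h]
  exact h.choose_spec

/-- The non-negative combination of vector states at paths of length `n` that has the given vertex
weights up to level `n`. -/
noncomputable def approxState (F : Br.Ar → ℝ) (β : ℝ) (φ : Br.V → ℝ) (n : ℕ) : Br.AF →L[ℂ] ℂ :=
  Br.pathSum n fun μ => (gibbsWeight F β φ μ : ℂ) • pathState (Br.extendPath μ)

theorem gibbsWeight_nonneg (h0 : ∀ w, 0 ≤ φ w) (μ : List Br.Ar) : 0 ≤ gibbsWeight F β φ μ :=
  mul_nonneg (Real.exp_pos _).le (h0 _)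

theorem gibbsWeight_nil : gibbsWeight F β φ [] = φ Br.top := by
  simp [gibbsWeight, pathWeight, endpoint]

theorem norm_approxState_le (hφ : IsHarmonic F β φ) (h0 : ∀ w, 0 ≤ φ w) (n : ℕ) :
    ‖approxState F β φ n‖ ≤ φ Br.top := by
  have h := hφ.pathSum_gibbsWeight (isPath_nil Br.top) (Nat.zero_le n)
  simp only [List.nil_prefix, if_true] at h
  rw [← gibbsWeight_nil (F := F) (β := β) (φ := φ), ← h]
  refine pathSum_rel (P := fun (T : Br.AF →L[ℂ] ℂ) (c : ℝ) => ‖T‖ ≤ c) (by simp)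
    (fun x x' y y' => norm_add_le_of_le) n fun μ _ _ => ?_
  rw [norm_smul, Complex.norm_real, Real.norm_of_nonneg (gibbsWeight_nonneg h0 μ)]
  exact mul_le_of_le_one_right (gibbsWeight_nonneg h0 μ) (norm_pathState_le _)

theorem approxState_star_mul_self (h0 : ∀ w, 0 ≤ φ w) (n : ℕ) (x : Br.AF) :
    ∃ c : ℝ, 0 ≤ c ∧ approxState F β φ n (star x * x) = c := by
  -- The real component is a dummy: the relation constrains only the functional.
  refine pathSum_rel (P := fun (T : Br.AF →L[ℂ] ℂ) (_ : ℝ) => ∃ c : ℝ, 0 ≤ c ∧ T (star x * x) = c)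
    ⟨0, le_rfl, by simp⟩ ?_ n (g' := 0) fun μ _ _ => ?_
  · rintro T T' _ _ ⟨c, hc, h⟩ ⟨c', hc', h'⟩
    exact ⟨c + c', add_nonneg hc hc', by rw [add_apply, h, h']; push_cast; rfl⟩
  · obtain ⟨c, hc, h⟩ := pathState_star_mul_self (Br.extendPath μ) x
    exact ⟨gibbsWeight F β φ μ * c, mul_nonneg (gibbsWeight_nonneg h0 μ) hc, by
      rw [smul_apply, h, smul_eq_mul, Complex.ofReal_mul]⟩

-- Up to level `n` the values are exact: the vector state at a path extending `ρ` only detects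
-- whether `μ = ν` is a prefix of `ρ`, and the weights of such `ρ` add up to that of `μ`.
open Classical in
theorem approxState_afUnit (hφ : IsHarmonic F β φ) {μ ν : List Br.Ar} {w : Br.V}
    (hμ : Br.IsPath Br.top μ w) (hν : Br.IsPath Br.top ν w) {n : ℕ} (hn : μ.length ≤ n) :
    approxState F β φ n (Br.afUnit μ ν) = ((if μ = ν then gibbsWeight F β φ μ else 0 : ℝ) : ℂ) := by
  have h1 : approxState F β φ n (Br.afUnit μ ν) = ((Br.pathSum n fun ρ =>
      if μ = ν then (if μ <+: ρ then gibbsWeight F β φ ρ else 0) else 0 : ℝ) : ℂ) := by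
    refine pathSum_rel (P := fun (T : Br.AF →L[ℂ] ℂ) (c : ℝ) => T (Br.afUnit μ ν) = c)
      (by simp) (fun x x' y y' h h' => by rw [add_apply, h, h']; push_cast; rfl) n
      fun ρ hρ hl => ?_
    obtain ⟨h2, h3⟩ := extendPath_spec hρ
    have h4 : μ = (Br.extendPath ρ).take μ.length ↔ μ <+: ρ := by
      rw [List.prefix_iff_eq_take, InfPath.take_of_le _ (hl ▸ hn : μ.length ≤ ρ.length), h3]
    rw [smul_apply, pathState_afUnit h2 hμ hν, smul_eq_mul]
    simp only [h4]
    split_ifs <;> simp_all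
  rw [h1]
  congr 1
  split_ifs with h
  · exact hφ.pathSum_gibbsWeight hμ hn
  · exact pathSum_rel (P := fun x y : ℝ => x = 0) rfl (by simp +contextual) n (g' := fun _ => 0)
      fun _ _ _ => rfl

/-- Every non-negative harmonic function gives the vertex weights of a positive functional. -/
theorem exists_hasVertexWeights (hφ : IsHarmonic F β φ) (h0 : ∀ w, 0 ≤ φ w) :
    ∃ ω : WeakDual ℂ Br.AF, OneParameterGroup.IsPositive ω ∧ HasVertexWeights F β ω φ ∧
      ∀ x, ‖ω x‖ ≤ φ Br.top * ‖x‖ := by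
  classical
  -- All approximants lie in the ball of radius `φ(v₀)`, which is weak* compact, so they converge
  -- along a free ultrafilter. On each matrix unit they are eventually constant, which identifies
  -- the limit there.
  obtain ⟨ω, hω, hlim⟩ := (WeakDual.isCompact_closedBall (0 : StrongDual ℂ Br.AF)
    (φ Br.top)).ultrafilter_le_nhds
    ((Filter.hyperfilter ℕ).map fun n => StrongDual.toWeakDual (approxState F β φ n)) (by
      rw [Ultrafilter.coe_map]
      refine Filter.tendsto_principal.2 (Filter.Eventually.of_forall fun n => ?_)
      simpa using norm_approxState_le hφ h0 n)
  have hx : ∀ x, Filter.Tendsto (fun n => approxState F β φ n x) (Filter.hyperfilter ℕ)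
      (nhds (ω x)) := fun x =>
    ((WeakDual.eval_continuous x).tendsto ω).comp hlim
  have hval : ∀ μ ν w, Br.IsPath Br.top μ w → Br.IsPath Br.top ν w →
      ω (Br.afUnit μ ν) = ((if μ = ν then gibbsWeight F β φ μ else 0 : ℝ) : ℂ) := by
    intro μ ν w hμ hν
    refine tendsto_nhds_unique (hx _) (tendsto_const_nhds.congr' ?_)
    have h1 : ∀ᶠ n in Filter.atTop, ((if μ = ν then gibbsWeight F β φ μ else 0 : ℝ) : ℂ) =
        approxState F β φ n (Br.afUnit μ ν) := by
      filter_upwards [Filter.eventually_ge_atTop μ.length] with n hn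
      exact (approxState_afUnit hφ hμ hν hn).symm
    exact Nat.hyperfilter_le_atTop h1
  refine ⟨ω, fun x => ?_, ⟨fun μ ν w hμ hν hne => ?_, fun μ w hμ => ?_⟩, fun x => ?_⟩
  -- Positivity survives the limit because the non-negative reals are closed in `ℂ`.
  · have hcl : IsClosed (Complex.ofReal '' Set.Ici 0) :=
      Complex.isometry_ofReal.isClosedEmbedding.isClosedMap _ isClosed_Ici
    obtain ⟨c, hc, h⟩ := hcl.mem_of_tendsto (hx (star x * x)) (Filter.Eventually.of_forall fun n =>
      let ⟨c, hc, h⟩ := approxState_star_mul_self (F := F) (β := β) h0 n x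
      ⟨c, hc, h.symm⟩)
    exact ⟨c, hc, h.symm⟩
  · rw [hval μ ν w hμ hν, if_neg hne, Complex.ofReal_zero]
  · rw [hval μ μ w hμ hμ, if_pos rfl, gibbsWeight, endpoint_eq hμ]
  · have : ‖WeakDual.toStrongDual ω‖ ≤ φ Br.top := by simpa using hω
    exact (WeakDual.toStrongDual ω).le_of_opNorm_le this x

end BratteliDiagram

/-! ### The projective limit as a cone of harmonic functions -/

namespace BratteliDiagram

variable {Br : BratteliDiagram.{u}} {F : Br.Ar → ℝ} {β : ℝ}

/-- A family of functions on the levels as a function on the vertices. -/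
def onVertices (ψ : ∀ j, Br.Level j → ℝ) (w : Br.V) : ℝ := ψ (Br.level w) ⟨w, rfl⟩

theorem onVertices_eq (ψ : ∀ j, Br.Level j → ℝ) {j : ℕ} (w : Br.Level j) :
    onVertices ψ w.1 = ψ j w := by
  obtain ⟨w, rfl⟩ := w
  rfl

theorem potentialMatrix_mulVec (ψ : ∀ j, Br.Level j → ℝ) (j : ℕ) (v : Br.Level j) :
    (Br.potentialMatrix F β j).mulVec (ψ (j + 1)) v =
      ∑ a ∈ Br.out v.1, Real.exp (-β * F a) * onVertices ψ (Br.r a) := by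
  classical
  have hlevel : ∀ a ∈ Br.out v.1, Br.level (Br.r a) = j + 1 := fun a ha => by
    rw [Br.level_range, RowFiniteGraph.mem_out.1 ha, v.2]
  simp only [Matrix.mulVec, dotProduct, potentialMatrix, Finset.sum_mul, Finset.sum_filter]
  rw [Finset.sum_comm]
  refine Finset.sum_congr rfl fun a ha => ?_
  rw [Finset.sum_eq_single ⟨Br.r a, hlevel a ha⟩]
  · rw [if_pos rfl, ← onVertices_eq ψ ⟨Br.r a, hlevel a ha⟩]
  · intro w _ hw
    rw [if_neg fun h => hw (Subtype.ext h.symm), zero_mul]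
  · exact fun h => absurd (Finset.mem_univ _) h

/-- Every vertex lies on exactly one level, so the equations of all levels together are the
harmonicity equation at all vertices. -/
theorem mem_limit_iff {ψ : ∀ j, Br.Level j → ℝ} : ψ ∈ (Br.potentialSystem F β).limit ↔
    (∀ w, 0 ≤ onVertices ψ w) ∧ IsHarmonic F β (onVertices ψ) := by
  constructor
  · rintro ⟨h0, h⟩
    refine ⟨fun w => h0 _ _, fun w => ?_⟩
    rw [← potentialMatrix_mulVec ψ (Br.level w) ⟨w, rfl⟩]
    exact congrFun (h (Br.level w)) ⟨w, rfl⟩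
  · rintro ⟨h0, h⟩
    refine ⟨fun j v => onVertices_eq ψ v ▸ h0 v.1, fun j => funext fun v => ?_⟩
    refine Eq.trans ?_ (potentialMatrix_mulVec ψ j v).symm
    rw [← h v.1, onVertices_eq]

/-- A function on the vertices as a family of functions on the levels. -/
def onLevels (φ : Br.V → ℝ) : ∀ j, Br.Level j → ℝ := fun _ w => φ w.1

theorem onLevels_onVertices (ψ : ∀ j, Br.Level j → ℝ) : onLevels (onVertices ψ) = ψ :=
  funext fun _ => funext fun w => onVertices_eq ψ w

theorem onVertices_top (ψ : ∀ j, Br.Level j → ℝ) : onVertices ψ Br.top = ψ 0 Br.topLevel :=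
  onVertices_eq ψ Br.topLevel

/-! ### Existence of a normalized element of the projective limit -/

namespace ProjectiveMatrixSystem

variable (M : Br.ProjectiveMatrixSystem)

/-- Prescribe `x` at level `n` and apply the matrices back to level `0`; the zeros beyond level `n`
are only placeholders. -/
theorem exists_eq_mulVec_of_lt (n : ℕ) (x : Br.Level n → ℝ) (hx : ∀ v, 0 ≤ x v) :
    ∃ ψ : ∀ j, Br.Level j → ℝ, (∀ j v, 0 ≤ ψ j v) ∧
      (∀ j < n, ψ j = (M.A j).mulVec (ψ (j + 1))) ∧ ψ n = x ∧ ∀ j, n < j → ψ j = 0 := by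
  induction n with
  | zero =>
    refine ⟨Function.update 0 0 x, fun j v => ?_, by simp, by simp, fun j hj => ?_⟩
    · by_cases hj : j = 0
      · subst hj
        simpa using hx v
      · simp [Function.update_of_ne hj]
    · simp [Function.update_of_ne hj.ne']
  | succ n ih =>
    obtain ⟨ψ, h0, hlt, hn, hgt⟩ := ih ((M.A n).mulVec x) fun v =>
      Finset.sum_nonneg fun w _ => mul_nonneg (M.nonneg n v w) (hx w)
    refine ⟨Function.update ψ (n + 1) x, fun j v => ?_, fun j hj => ?_, by simp, fun j hj => ?_⟩
    · by_cases hj : j = n + 1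
      · subst hj
        simpa using hx v
      · simpa [Function.update_of_ne hj] using h0 j v
    · rw [Function.update_of_ne hj.ne]
      rcases Nat.lt_succ_iff_lt_or_eq.1 hj with h | rfl
      · rw [Function.update_of_ne (by omega), hlt j h]
      · rw [Function.update_self, hn]
    · rw [Function.update_of_ne hj.ne', hgt j (by omega)]

theorem eq_matProd_mulVec {ψ : ∀ j, Br.Level j → ℝ} {n : ℕ}
    (h : ∀ j < n, ψ j = (M.A j).mulVec (ψ (j + 1))) {k : ℕ} (hk : k ≤ n) :
    ψ 0 = (Br.matProd M.A k).mulVec (ψ k) := by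
  classical
  induction k with
  | zero =>
    rw [matProd]
    convert! (Matrix.one_mulVec (ψ 0)).symm
  | succ k ih => rw [matProd, ← Matrix.mulVec_mulVec, ← h k hk, ih (by omega)]

theorem matProd_nonneg (k : ℕ) (v : Br.Level 0) (w : Br.Level k) : 0 ≤ Br.matProd M.A k v w := by
  classical
  induction k with
  | zero =>
    rw [matProd, Matrix.one_apply]
    split_ifs <;> simp
  | succ k ih => exact Finset.sum_nonneg fun x _ => mul_nonneg (ih x) (M.nonneg k x w)

theorem matProd_top_pos (k : ℕ) (w : Br.Level k) : 0 < Br.matProd M.A k Br.topLevel w := by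
  classical
  refine lt_of_le_of_ne (M.matProd_nonneg k _ w) (Ne.symm ?_)
  rcases Nat.eq_zero_or_pos k with rfl | hk
  · have : w = Br.topLevel := Subtype.ext ((Br.level_eq_zero _).1 w.2)
    subst this
    simp [matProd]
  · exact M.prod_ne_zero k hk w

theorem nonempty_level (n : ℕ) : Nonempty (Br.Level n) := by
  induction n with
  | zero => exact ⟨Br.topLevel⟩
  | succ n ih =>
    obtain ⟨v⟩ := ih
    obtain ⟨a, ha⟩ := Br.no_sink v.1
    exact ⟨⟨Br.r a, by rw [Br.level_range, ha, v.2]⟩⟩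

/-- The bound is independent of `n`: after normalization `1 = ∑_v (A^{(1)} ⋯ A^{(j)})_{v₀,v} ψ^j_v`
for `j ≤ n`, with non-negative terms. Starting from the constant vector `1` at level `n` makes the
value at `v₀` positive. -/
theorem exists_normalized_of_lt (n : ℕ) : ∃ ψ : ∀ j, Br.Level j → ℝ, (∀ j v, 0 ≤ ψ j v) ∧
    (∀ j < n, ψ j = (M.A j).mulVec (ψ (j + 1))) ∧ ψ 0 Br.topLevel = 1 ∧
    ∀ j v, ψ j v ≤ (Br.matProd M.A j Br.topLevel v)⁻¹ := by
  obtain ⟨ψ, h0, hlt, hn, hgt⟩ := M.exists_eq_mulVec_of_lt n 1 fun _ => zero_le_one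
  have hsum : ∀ k ≤ n, ψ 0 Br.topLevel = ∑ w, Br.matProd M.A k Br.topLevel w * ψ k w :=
    fun k hk => congrFun (M.eq_matProd_mulVec hlt hk) Br.topLevel
  have hpos : 0 < ψ 0 Br.topLevel := by
    have := nonempty_level (Br := Br) n
    rw [hsum n le_rfl, hn]
    exact Finset.sum_pos (fun w _ => by simpa using M.matProd_top_pos n w) Finset.univ_nonempty
  refine ⟨(ψ 0 Br.topLevel)⁻¹ • ψ, fun j v => mul_nonneg (inv_nonneg.2 hpos.le) (h0 j v),
    fun j hj => ?_, inv_mul_cancel₀ hpos.ne', fun j v => ?_⟩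
  · rw [Pi.smul_apply, Pi.smul_apply, Matrix.mulVec_smul, ← hlt j hj]
  · rcases le_or_gt j n with hj | hj
    · have h1 : Br.matProd M.A j Br.topLevel v * ψ j v ≤ ψ 0 Br.topLevel := by
        rw [hsum j hj]
        exact Finset.single_le_sum (f := fun w => Br.matProd M.A j Br.topLevel w * ψ j w)
          (fun w _ => mul_nonneg (M.matProd_nonneg j _ w) (h0 j w)) (Finset.mem_univ v)
      change (ψ 0 Br.topLevel)⁻¹ * ψ j v ≤ _
      rw [inv_mul_le_iff₀ hpos, ← div_eq_mul_inv, le_div_iff₀ (M.matProd_top_pos j v), mul_comm]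
      exact h1
    · change (ψ 0 Br.topLevel)⁻¹ * ψ j v ≤ _
      rw [hgt j hj, Pi.zero_apply, mul_zero]
      exact inv_nonneg.2 (M.matProd_nonneg j _ v)

/-- The projective limit of a projective matrix system contains a normalized element. -/
theorem exists_mem_limit : ∃ ψ ∈ M.limit, ψ 0 Br.topLevel = 1 := by
  choose ψ h0 hlt h1 hle using M.exists_normalized_of_lt
  -- The uniform bounds place all truncated solutions in a product of compact intervals.
  have hK : IsCompact (Set.univ.pi fun j => Set.univ.pi fun v =>
      Set.Icc 0 (Br.matProd M.A j Br.topLevel v)⁻¹ : Set (∀ j, Br.Level j → ℝ)) :=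
    isCompact_univ_pi fun j => isCompact_univ_pi fun v => isCompact_Icc
  obtain ⟨φ, hφ, hlim⟩ := hK.ultrafilter_le_nhds ((Filter.hyperfilter ℕ).map ψ) (by
    rw [Ultrafilter.coe_map]
    exact Filter.tendsto_principal.2 (Filter.Eventually.of_forall fun n j _ v _ =>
      ⟨h0 n j v, hle n j v⟩))
  have hlim : Filter.Tendsto ψ (Filter.hyperfilter ℕ) (nhds φ) := hlim
  have hj : ∀ j, Filter.Tendsto (fun n => ψ n j) (Filter.hyperfilter ℕ) (nhds (φ j)) :=
    tendsto_pi_nhds.1 hlim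
  refine ⟨φ, ⟨fun j v => (hφ j trivial v trivial).1, fun j => ?_⟩, ?_⟩
  · have hcont : Continuous fun x : Br.Level (j + 1) → ℝ => (M.A j).mulVec x := by fun_prop
    refine tendsto_nhds_unique (hj j) (((hcont.tendsto _).comp (hj (j + 1))).congr' ?_)
    -- Each equation involves only two levels and holds for all truncations with `n > j`, so it
    -- passes to the limit.
    have h2 : ∀ᶠ n in Filter.atTop, (M.A j).mulVec (ψ n (j + 1)) = ψ n j := by
      filter_upwards [Filter.eventually_gt_atTop j] with n hn
      exact (hlt n j hn).symm
    exact Nat.hyperfilter_le_atTop h2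
  · exact tendsto_nhds_unique (tendsto_pi_nhds.1 (hj 0) Br.topLevel)
      (by simp only [h1]; exact tendsto_const_nhds)

end ProjectiveMatrixSystem

/-! ### The cone of KMS functionals and the homeomorphism -/

open OneParameterGroup

/-- The positive functional with given vertex weights. -/
noncomputable def functionalOf (ψ : (Br.potentialSystem F β).limit) : WeakDual ℂ Br.AF :=
  (exists_hasVertexWeights (mem_limit_iff.1 ψ.2).2 (mem_limit_iff.1 ψ.2).1).choose

theorem functionalOf_spec (ψ : (Br.potentialSystem F β).limit) :
    IsPositive (functionalOf ψ) ∧ HasVertexWeights F β (functionalOf ψ) (onVertices ψ) ∧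
      ∀ x, ‖functionalOf ψ x‖ ≤ onVertices ψ Br.top * ‖x‖ :=
  (exists_hasVertexWeights (mem_limit_iff.1 ψ.2).2 (mem_limit_iff.1 ψ.2).1).choose_spec

theorem functionalOf_mem (ψ : (Br.potentialSystem F β).limit) :
    functionalOf ψ ∈ (Br.gaugeActionAF F).positiveKMS β :=
  ⟨(functionalOf_spec ψ).1, (functionalOf_spec ψ).2.1.kmsCondition⟩

theorem HasVertexWeights.apply_one {ω : WeakDual ℂ Br.AF} {φ : Br.V → ℝ}
    (h : HasVertexWeights F β ω φ) : ω 1 = φ Br.top := by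
  rw [← afUnit_nil, h.2 _ _ (isPath_nil Br.top)]
  simp [pathWeight]

/-- The sequence of vertex weights of a positive KMS functional, which lies in the projective
limit. -/
theorem onLevels_vertexWeight_mem {ω : WeakDual ℂ Br.AF}
    (hω : ω ∈ (Br.gaugeActionAF F).positiveKMS β) :
    onLevels (vertexWeight F β ω) ∈ (Br.potentialSystem F β).limit :=
  mem_limit_iff.2 ⟨vertexWeight_nonneg hω.1, (hasVertexWeights_of_kms hω).isHarmonic⟩

theorem functionalOf_onLevels {ω : WeakDual ℂ Br.AF}
    (hω : ω ∈ (Br.gaugeActionAF F).positiveKMS β) :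
    functionalOf ⟨_, onLevels_vertexWeight_mem hω⟩ = ω :=
  (functionalOf_spec ⟨_, onLevels_vertexWeight_mem hω⟩).2.1.eq (hasVertexWeights_of_kms hω)

theorem onLevels_functionalOf (ψ : (Br.potentialSystem F β).limit) :
    onLevels (vertexWeight F β (functionalOf ψ)) = ψ := by
  have h : vertexWeight F β (functionalOf ψ) = onVertices ψ.1 :=
    funext (functionalOf_spec ψ).2.1.vertexWeight_eq
  rw [h, onLevels_onVertices]

/-- By uniqueness `ω` is the functional constructed from its own weights, and that one satisfies the
bound by construction. -/
theorem norm_apply_le_of_kms {ω : WeakDual ℂ Br.AF}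
    (hω : ω ∈ (Br.gaugeActionAF F).positiveKMS β) (x : Br.AF) :
    ‖ω x‖ ≤ vertexWeight F β ω Br.top * ‖x‖ := by
  have h := (functionalOf_spec ⟨_, onLevels_vertexWeight_mem hω⟩).2.2 x
  rwa [functionalOf_onLevels hω] at h

theorem isPositive_smul {ω : WeakDual ℂ Br.AF} (h : IsPositive ω) {t : ℝ} (ht : 0 ≤ t) :
    IsPositive (t • ω) := fun a => by
  obtain ⟨c, hc, hca⟩ := h a
  refine ⟨t * c, mul_nonneg ht hc, ?_⟩
  change t • ω (star a * a) = _
  rw [hca, Complex.real_smul, Complex.ofReal_mul]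

theorem kmsCondition_smul {ω : WeakDual ℂ Br.AF} (h : (Br.gaugeActionAF F).KMSCondition β ω)
    (t : ℝ) : (Br.gaugeActionAF F).KMSCondition β (t • ω) := fun a b f hf hb =>
  congrArg (t • ·) (h a b f hf hb)

/-- This is what puts the zero functional into the cone. -/
theorem nonempty_kmsStates (F : Br.Ar → ℝ) (β : ℝ) :
    ((Br.gaugeActionAF F).kmsStates β).Nonempty := by
  obtain ⟨ψ, hψ, h1⟩ := (Br.potentialSystem F β).exists_mem_limit
  have h := functionalOf_mem ⟨ψ, hψ⟩
  refine ⟨functionalOf ⟨ψ, hψ⟩, h.1, ?_, h.2⟩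
  rw [(functionalOf_spec ⟨ψ, hψ⟩).2.1.apply_one, onVertices_top]
  exact congrArg Complex.ofReal h1

theorem kmsCone_eq_positiveKMS (F : Br.Ar → ℝ) (β : ℝ) :
    (Br.gaugeActionAF F).kmsCone β = (Br.gaugeActionAF F).positiveKMS β := by
  ext ω
  constructor
  · rintro ⟨t, ht, ν, ⟨hpos, -, hkms⟩, rfl⟩
    exact ⟨isPositive_smul hpos ht, kmsCondition_smul hkms t⟩
  · intro hω
    set c := vertexWeight F β ω Br.top with hc
    have hc0 : 0 ≤ c := vertexWeight_nonneg hω.1 _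
    rcases hc0.eq_or_lt with h0 | h0
    -- If `ω(1) = 0`, the norm bound gives `ω = 0`, and any KMS state serves as `ν`.
    · obtain ⟨ν, hν⟩ := nonempty_kmsStates F β
      refine ⟨0, le_rfl, ν, hν, ?_⟩
      refine DFunLike.ext _ _ fun x => ?_
      change ω x = (0 : ℝ) • ν x
      rw [zero_smul, ← norm_le_zero_iff]
      have h := norm_apply_le_of_kms hω x
      rwa [← hc, ← h0, zero_mul] at h
    · refine ⟨c, hc0, c⁻¹ • ω, ⟨isPositive_smul hω.1 (inv_nonneg.2 hc0), ?_,
        kmsCondition_smul hω.2 _⟩, ?_⟩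
      · change c⁻¹ • ω 1 = 1
        rw [(hasVertexWeights_of_kms hω).apply_one, ← hc, Complex.real_smul, ← Complex.ofReal_mul,
          inv_mul_cancel₀ h0.ne', Complex.ofReal_one]
      · refine DFunLike.ext _ _ fun x => ?_
        change ω x = c • c⁻¹ • ω x
        rw [smul_smul, mul_inv_cancel₀ h0.ne', one_smul]

theorem continuous_vertexWeight (F : Br.Ar → ℝ) (β : ℝ) (w : Br.V) :
    Continuous fun ω : WeakDual ℂ Br.AF => vertexWeight F β ω w :=
  continuous_const.mul (Complex.continuous_re.comp (WeakDual.eval_continuous _))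

theorem continuous_onVertices (w : Br.V) :
    Continuous fun ψ : (Br.potentialSystem F β).limit => onVertices ψ.1 w :=
  (continuous_apply (⟨w, rfl⟩ : Br.Level (Br.level w))).comp
    ((continuous_apply (Br.level w)).comp continuous_subtype_val)

theorem continuous_functionalOf_afUnit {μ ν : List Br.Ar} {w : Br.V} (hμ : Br.IsPath Br.top μ w)
    (hν : Br.IsPath Br.top ν w) :
    Continuous fun ψ : (Br.potentialSystem F β).limit => functionalOf ψ (Br.afUnit μ ν) := by
  by_cases h : μ = ν
  · subst h
    simp only [fun ψ => (functionalOf_spec (F := F) (β := β) ψ).2.1.2 μ w hμ]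
    refine Complex.continuous_ofReal.comp (continuous_const.mul (continuous_onVertices w))
  · simp only [fun ψ => (functionalOf_spec (F := F) (β := β) ψ).2.1.1 μ ν w hμ hν h]
    exact continuous_const

/-- On matrix units the value is `0` or a multiple of one coordinate of `ψ`. The set of good `x` is
a subspace, and it is closed because the norms of the functionals are locally bounded in `ψ`. -/
theorem continuous_functionalOf_apply (x : Br.AF) :
    Continuous fun ψ : (Br.potentialSystem F β).limit => functionalOf ψ x := by
  let N : Submodule ℂ Br.AF :=
    { carrier := {x | Continuous fun ψ : (Br.potentialSystem F β).limit => functionalOf ψ x}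
      add_mem' := fun {x y} hx hy => by
        simp only [Set.mem_ofPred_eq, map_add]
        exact Continuous.add hx hy
      zero_mem' := by
        simp only [Set.mem_ofPred_eq, map_zero]
        exact continuous_const
      smul_mem' := fun c x hx => by
        simp only [Set.mem_ofPred_eq, map_smul]
        exact Continuous.const_smul hx c }
  refine mem_of_afUnit_mem N ?_ (fun μ ν w hμ hν => continuous_functionalOf_afUnit hμ hν) x
  refine isClosed_of_closure_subset fun x hx => ?_
  refine continuous_iff_continuousAt.2 fun ψ₀ => Metric.continuousAt_iff'.2 fun ε hε => ?_
  -- The added `1` makes `C` positive and a strict bound for the norms on a neighbourhood of `ψ₀`;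
  -- with `‖x - y‖ < ε/(3C)` each of the three errors is below `ε/3`.
  set C := onVertices ψ₀.1 Br.top + 1 with hC
  have hC0 : 0 < C := add_pos_of_nonneg_of_pos ((mem_limit_iff.1 ψ₀.2).1 _) one_pos
  obtain ⟨y, hy, hyx⟩ := Metric.mem_closure_iff.1 hx (ε / (3 * C)) (by positivity)
  have hbound : ∀ ψ : (Br.potentialSystem F β).limit, onVertices ψ.1 Br.top < C →
      dist (functionalOf ψ x) (functionalOf ψ y) < ε / 3 := fun ψ hψ => by
    rw [dist_eq_norm, ← map_sub]
    refine ((functionalOf_spec ψ).2.2 _).trans_lt ?_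
    rw [← dist_eq_norm]
    calc _ ≤ C * dist x y := mul_le_mul_of_nonneg_right hψ.le dist_nonneg
      _ < C * (ε / (3 * C)) := mul_lt_mul_of_pos_left hyx hC0
      _ = ε / 3 := by field_simp
  have hy : Continuous fun ψ : (Br.potentialSystem F β).limit => functionalOf ψ y := hy
  filter_upwards [(continuous_onVertices Br.top).continuousAt.eventually_lt_const (lt_add_one _),
    Metric.continuousAt_iff'.1 (hy.continuousAt (x := ψ₀)) (ε / 3) (by positivity)] with ψ h1 h2
  have h3 := hbound ψ h1
  have h4 := hbound ψ₀ (lt_add_one _)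
  rw [dist_comm] at h4
  linarith [dist_triangle4 (functionalOf ψ x) (functionalOf ψ y) (functionalOf ψ₀ y)
    (functionalOf ψ₀ x)]

variable (Br) in
/-- The homeomorphism from the cone of KMS functionals onto the projective limit. -/
noncomputable def kmsHomeomorph (F : Br.Ar → ℝ) (β : ℝ) :
    (Br.gaugeActionAF F).kmsCone β ≃ₜ (Br.potentialSystem F β).limit where
  toFun ω := ⟨onLevels (vertexWeight F β ω.1),
    onLevels_vertexWeight_mem (kmsCone_eq_positiveKMS F β ▸ ω.2)⟩
  invFun ψ := ⟨functionalOf ψ, kmsCone_eq_positiveKMS F β ▸ functionalOf_mem ψ⟩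
  left_inv ω := Subtype.ext (functionalOf_onLevels (kmsCone_eq_positiveKMS F β ▸ ω.2))
  right_inv ψ := Subtype.ext (onLevels_functionalOf ψ)
  continuous_toFun := Continuous.subtype_mk (continuous_pi fun j => continuous_pi fun w : Br.Level j =>
    (continuous_vertexWeight F β w.1).comp continuous_subtype_val) _
  continuous_invFun := Continuous.subtype_mk
    (WeakDual.continuous_of_continuous_eval continuous_functionalOf_apply) _

theorem vertexWeight_add_smul (ω ω' : WeakDual ℂ Br.AF) (a b : ℝ) (w : Br.V) :
    vertexWeight F β (a • ω + b • ω') w = a * vertexWeight F β ω w + b * vertexWeight F β ω' w := by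
  have h : ∀ x, (a • ω + b • ω') x = a • ω x + b • ω' x := fun _ => rfl
  rw [vertexWeight, h, Complex.add_re, Complex.smul_re, Complex.smul_re, vertexWeight,
    vertexWeight, smul_eq_mul, smul_eq_mul]
  ring

end BratteliDiagram

theorem proposition3p4 (Br : BratteliDiagram.{u}) (F : Br.Ar → ℝ) (β : ℝ) :
    (Br.gaugeActionAF F).kmsCone β = (Br.gaugeActionAF F).positiveKMS β ∧
    ∃ h : (Br.gaugeActionAF F).kmsCone β ≃ₜ (Br.potentialSystem F β).limit,
      IsAffineBetween h ∧
      (fun ω => (h ω : ∀ j, Br.Level j → ℝ)) '' {ω | (ω : WeakDual ℂ Br.AF) ∈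
          (Br.gaugeActionAF F).kmsStates β} =
        {ψ | ψ ∈ (Br.potentialSystem F β).limit ∧ ψ 0 Br.topLevel = 1} := by
  refine ⟨Br.kmsCone_eq_positiveKMS F β, Br.kmsHomeomorph F β, ?_, ?_⟩
  · intro x y z a b _ _ _ hz
    refine funext fun j => funext fun w => ?_
    change BratteliDiagram.vertexWeight F β z.1 w.1 = a * BratteliDiagram.vertexWeight F β x.1 w.1 +
      b * BratteliDiagram.vertexWeight F β y.1 w.1
    rw [hz, BratteliDiagram.vertexWeight_add_smul]
  -- The empty path has weight `0` and range `v₀`, so `ω(1)` is the coordinate at `v₀`; hence states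
  -- correspond to normalized sequences.
  · have hone : ∀ ω : (Br.gaugeActionAF F).kmsCone β,
        ω.1 1 = ((Br.kmsHomeomorph F β ω).1 0 Br.topLevel : ℂ) := fun ω => by
      have hω : ω.1 ∈ (Br.gaugeActionAF F).positiveKMS β :=
        BratteliDiagram.kmsCone_eq_positiveKMS F β ▸ ω.2
      exact (BratteliDiagram.hasVertexWeights_of_kms hω).apply_one
    ext ψ
    constructor
    · rintro ⟨ω, ⟨-, h1, -⟩, rfl⟩
      refine ⟨(Br.kmsHomeomorph F β ω).2, ?_⟩
      rw [hone] at h1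
      exact_mod_cast h1
    · rintro ⟨hψ, h1⟩
      have h2 := (Br.kmsHomeomorph F β).apply_symm_apply ⟨ψ, hψ⟩
      set ω := (Br.kmsHomeomorph F β).symm ⟨ψ, hψ⟩
      have hω : ω.1 ∈ (Br.gaugeActionAF F).positiveKMS β :=
        BratteliDiagram.kmsCone_eq_positiveKMS F β ▸ ω.2
      refine ⟨ω, ⟨hω.1, ?_, hω.2⟩, congrArg Subtype.val h2⟩
      rw [hone, h2]
      change ((ψ 0 Br.topLevel : ℝ) : ℂ) = 1
      rw [h1, Complex.ofReal_one]
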